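/- Conventions. An $\omega$-Stone space is a locally compact, totally disconnected Hausdorff space with a countable base. $\omega_1$ is the set of countable ordinals. For a subset $S$ of a topological space, $S'$ is the set of its limit points and $\overline S$ its closure. For an $\omega$-Stone space $W$ put $W^{(0)}=W$, $W^{(\xi+1)}=(W^{(\xi)})'$, $W^{(\eta)}=\bigcap_{\xi<\eta}W^{(\xi)}$ for limit ordinals $\eta$, and $W^{[\xi]}=W^{(\xi)}\setminus W^{(\xi+1)}$. Let $\nu(W)=\min\{\xi : W^{(\xi)}=W^{(\xi+1)}\}$; let $K(W)=W^{(\nu(W))}$ be the perfect kernel, with the subspace topology; let $\lambda(W)=\min\{\xi : W^{(\xi)}\setminus K(W)\text{ is closed}\}$. The rank function $r_W\colon K(W)\to\omega_1$ is $r_W(x)=\min\{\xi\in\omega_1 : x\notin\overline{W^{(\xi)}\setminus K(W)}\}$, and $K_\xi(W)=\{x\in K(W) : r_W(x)>\xi\}$. Let $\rho(W)=\min\{\xi : \overline{W^{[\xi]}}\text{ is compact}\}$ and $\rho_U(W)=\min\{\xi : K_\xi(W)\text{ is compact}\}$. The space $W$ is strongly uniform if $\nu(W)=\lambda(W)$ and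 $\rho_U(W)=\rho(W)$. Let $\mathscr D_1$ be the Cantor set and $\mathscr D_0$ the Cantor set minus a point. A map $r\colon K\to\omega_1$ is upper semi-continuous if $\{x\in K : r(x)\ge\xi\}$ is closed for all $\xi\in\omega_1$. Pairs $(U,r)$ and $(V,s)$, with $U,V$ topological spaces and $r\colon U\to\omega_1$, $s\colon V\to\omega_1$ maps, are isomorphic if there is a homeomorphism $\varphi\colon U\to V$ with $s\circ\varphi=r$. Theorem. (1) A strongly uniform $\omega$-Stone space is determined up to homeomorphism by the isomorphism type of $(K(W),r_W)$: strongly uniform $\omega$-Stone spaces $W$ and $X$ are homeomorphic if and only if $(K(W),r_W)\cong(K(X),r_X)$. (2) For every non-empty strongly uniform $\omega$-Stone space $W$, the space $K(W)$ is homeomorphic to $\mathscr D_0$ or $\mathscr D_1$ and $r_W$ is upper semi-continuous; and the map $W\mapsto(K(W),r_W)$ induces a bijection from the homeomorphism classes of non-empty strongly uniform $\omega$-Stone spaces onto the isomorphism classes of pairs $(K,r)$, where $K$ is (a homeomorphic copy of) $\mathscr D_0$ or $\mathscr D_1$ and $r\colon K\to\omega_1$ is upper semi-continuous. -/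

import Mathlib

open Topology Set
open scoped Ordinal

universe u v

namespace OmegaStone

/-- An `ω`-Stone space: a locally compact, Hausdorff, totally disconnected space with a countable
base. These are the Stone spaces of countable Boolean rings, equivalently the separable metrisable
Boolean spaces; metrisability follows from the listed properties. -/
class IsOmegaStone (W : Type u) [TopologicalSpace W] : Prop where
  t2 : T2Space W
  locallyCompact : LocallyCompactSpace W
  totallyDisconnected : TotallyDisconnectedSpace W
  secondCountable : SecondCountableTopology W

/-- The set `ω₁` of all countable ordinals. -/
abbrev CountableOrdinal : Type 1 := Set.Iio (ω₁ : Ordinal.{0})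

noncomputable section

/-- The Cantor-Bendixson sequence: `W^(0) = W`, `W^(ξ+1)` is the set of limit points of `W^(ξ)`,
and intersections are taken at limit ordinals. -/
def cb (W : Type u) [TopologicalSpace W] (ξ : Ordinal.{0}) : Set W :=
  Ordinal.limitRecOn (motive := fun _ => Set W) ξ univ
    (fun _ S => derivedSet S) (fun η _ S => ⋂ (ζ : Ordinal.{0}) (h : ζ < η), S ζ h)

theorem cb_zero (W : Type u) [TopologicalSpace W] : cb W 0 = univ := by
  simp [cb]

theorem cb_succ (W : Type u) [TopologicalSpace W] (ξ : Ordinal.{0}) :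
    cb W (ξ + 1) = derivedSet (cb W ξ) := by
  simp [cb]

theorem cb_limit (W : Type u) [TopologicalSpace W] (η : Ordinal.{0}) (hη : Order.IsSuccLimit η) :
    cb W η = ⋂ (ζ : Ordinal.{0}) (_ : ζ < η), cb W ζ := by
  simp only [cb]
  rw [Ordinal.limitRecOn_limit _ _ _ _ hη]

/-- `W^[ξ] = W^(ξ) - W^(ξ+1)`. -/
def cbLayer (W : Type u) [TopologicalSpace W] (ξ : Ordinal.{0}) : Set W :=
  cb W ξ \ cb W (ξ + 1)

/-- `ν(W) = min {ξ | W^(ξ) = W^(ξ+1)}`. -/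
def nu (W : Type u) [TopologicalSpace W] : Ordinal.{0} :=
  sInf {ξ | cb W ξ = cb W (ξ + 1)}

/-- The perfect kernel `K(W) = W^(ν(W))`. -/
def kernel (W : Type u) [TopologicalSpace W] : Set W := cb W (nu W)

/-- `λ(W) = min {ξ | W^(ξ) - K(W) is closed}`. -/
def lam (W : Type u) [TopologicalSpace W] : Ordinal.{0} :=
  sInf {ξ | IsClosed (cb W ξ \ kernel W)}

theorem rank_lt (W : Type u) [TopologicalSpace W] (x : W) :
    sInf {ξ : Ordinal.{0} | ξ < ω₁ ∧ x ∉ closure (cb W ξ \ kernel W)} < ω₁ := by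
  rcases Set.eq_empty_or_nonempty
    {ξ : Ordinal.{0} | ξ < ω₁ ∧ x ∉ closure (cb W ξ \ kernel W)} with h | h
  · rw [h, Ordinal.sInf_empty]
    exact Ordinal.omega_pos 1
  · exact (csInf_mem h).1

/-- The rank function `r_W : K(W) → ω₁`,
`r_W(x) = min {ξ ∈ ω₁ | x ∉ closure (W^(ξ) - K(W))}`. -/
def rank (W : Type u) [TopologicalSpace W] (x : kernel W) : CountableOrdinal :=
  ⟨sInf {ξ : Ordinal.{0} | ξ < ω₁ ∧ (x : W) ∉ closure (cb W ξ \ kernel W)}, rank_lt W x⟩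

/-- `K_ξ(W) = {w ∈ K(W) | r_W(w) > ξ}`. -/
def kernelAbove (W : Type u) [TopologicalSpace W] (ξ : Ordinal.{0}) : Set W :=
  {w | ∃ h : w ∈ kernel W, ξ < (rank W ⟨w, h⟩ : Ordinal.{0})}

/-- The compact rank `ρ(W) = min {ξ | closure W^[ξ] is compact}`. -/
def rho (W : Type u) [TopologicalSpace W] : Ordinal.{0} :=
  sInf {ξ | IsCompact (closure (cbLayer W ξ))}

/-- The uniform compact rank `ρ_U(W) = min {ξ | K_ξ(W) is compact}`. -/
def rhoU (W : Type u) [TopologicalSpace W] : Ordinal.{0} :=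
  sInf {ξ | IsCompact (kernelAbove W ξ)}

end

/-- `W` is uniform: `ν(W) = λ(W)`. -/
def IsUniform (W : Type u) [TopologicalSpace W] : Prop := nu W = lam W

/-- `W` is strongly uniform: uniform, and `ρ_U(W) = ρ(W)`. -/
def IsStronglyUniform (W : Type u) [TopologicalSpace W] : Prop :=
  IsUniform W ∧ rhoU W = rho W

/-- `(U, r) ≅ (V, s)`: a homeomorphism `φ : U → V` with `s ∘ φ = r`. -/
def RankIso {U : Type u} {V : Type v} [TopologicalSpace U] [TopologicalSpace V]
    (r : U → CountableOrdinal) (s : V → CountableOrdinal) : Prop :=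
  ∃ φ : U ≃ₜ V, ∀ x, s (φ x) = r x

/-- The Cantor set. -/
abbrev D₁ : Type := cantorSet

/-- The Cantor set minus a point. -/
abbrev D₀ : Type := (cantorSet \ {0} : Set ℝ)

/-- The pair `(K, r)` is admissible: `K` is a copy of `D₀` or of `D₁`, and `r : K → ω₁` is upper
semi-continuous. -/
def IsAdmissible {K : Type u} [TopologicalSpace K] (r : K → CountableOrdinal) : Prop :=
  (Nonempty (K ≃ₜ D₀) ∨ Nonempty (K ≃ₜ D₁)) ∧ UpperSemicontinuous r

/-- A non-empty strongly uniform `ω`-Stone space. -/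
structure StronglyUniformSpace : Type (u + 1) where
  carrier : Type u
  [top : TopologicalSpace carrier]
  [isOmegaStone : IsOmegaStone carrier]
  [nonempty : Nonempty carrier]
  isStronglyUniform : IsStronglyUniform carrier

attribute [instance] StronglyUniformSpace.top StronglyUniformSpace.isOmegaStone
  StronglyUniformSpace.nonempty

/-- An admissible pair `(K, r)`. -/
structure RankPair : Type (u + 1) where
  carrier : Type u
  [top : TopologicalSpace carrier]
  rank : carrier → CountableOrdinal
  isAdmissible : IsAdmissible rank

attribute [instance] RankPair.top

/-- Homeomorphism of strongly uniform spaces. -/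
instance stronglyUniformSetoid : Setoid StronglyUniformSpace.{u} where
  r W X := Nonempty (W.carrier ≃ₜ X.carrier)
  iseqv :=
    { refl := fun W => ⟨Homeomorph.refl W.carrier⟩
      symm := fun ⟨φ⟩ => ⟨φ.symm⟩
      trans := fun ⟨φ⟩ ⟨ψ⟩ => ⟨φ.trans ψ⟩ }

/-- Isomorphism of pairs `(K, r)`. -/
instance rankPairSetoid : Setoid RankPair.{u} where
  r p q := RankIso p.rank q.rank
  iseqv :=
    { refl := fun p => ⟨Homeomorph.refl p.carrier, fun _ => rfl⟩
      symm := fun ⟨φ, h⟩ => ⟨φ.symm, fun x => by rw [← h, φ.apply_symm_apply]⟩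
      trans := fun ⟨φ, h⟩ ⟨ψ, k⟩ => ⟨φ.trans ψ, fun x => (k (φ x)).trans (h x)⟩ }

/-- The homeomorphism classes of non-empty strongly uniform `ω`-Stone spaces. -/
abbrev StronglyUniformClass : Type (u + 1) := Quotient stronglyUniformSetoid.{u}

/-- The isomorphism classes of admissible pairs. -/
abbrev RankPairClass : Type (u + 1) := Quotient rankPairSetoid.{u}

end OmegaStone

/-! Give each point of `W` a height: its Cantor-Bendixson level off the kernel `K`, its rank on `K`.
Then around any `x` all other points off `K` are lower than `x`, and every smaller height occurs off
`K` arbitrarily close to `x` (`IsHeight.cbHeight`). Most of the argument uses only these two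
properties.

Uniqueness. The one-point compactification inherits a height function, with `∞` added to the kernel
at height `ρ(W)` (`IsHeight.onePoint`). For compact spaces, a height-preserving homeomorphism of
kernels extends to the whole spaces once the layers off the kernels have equal cardinalities
(`exists_homeomorph_extending`). This is a back-and-forth over clopen sets, whose core is
`Matched.split_aux`. Strong uniformity recovers the needed data from `(K, r)`: by `ν = λ` the layer
at `ξ` is infinite if some rank exceeds `ξ` and empty otherwise, and `ρ = ρ_U` is read off from `(K,
r)`. The extension fixes `∞`, so it restricts to `W ≃ₜ X`.

Shape of the invariant. `K` has no isolated points, so the same back-and-forth, now with a base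
point, identifies `K` or its compactification with the Cantor set. Heights are upper semicontinuous,
hence so is the rank.

Surjectivity. Over a dense enough countable family of points of `K`, attach compact scattered spaces
of prescribed heights, shrinking towards `K` (`glueSet`). The scattered spaces come from the same
construction over a single point, by transfinite induction. The glued space retracts properly onto
`K`, and each point off `K` lies below its image in height; this yields strong uniformity
(`Realisation.isStronglyUniform`). -/

namespace OmegaStone

open TopologicalSpace Filter

/-! ### The one-point compactification as a second countable Stone space. -/

section Basic

variable {W : Type u} [TopologicalSpace W] [T2Space W] [LocallyCompactSpace W]
  [TotallyDisconnectedSpace W]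

theorem exists_isCompact_isOpen_subset {x : W} {U : Set W} (hU : U ∈ 𝓝 x) :
    ∃ V : Set W, IsCompact V ∧ IsOpen V ∧ x ∈ V ∧ V ⊆ U := by
  obtain ⟨C, hC, hCU, hCc⟩ := local_compact_nhds hU
  obtain ⟨V, hV, hxV, hVC⟩ :=
    (loc_compact_Haus_tot_disc_of_zero_dim (H := W)).mem_nhds_iff.1 hC
  exact ⟨V, hCc.of_isClosed_subset hV.isClosed hVC, hV.isOpen, hxV, hVC.trans hCU⟩

omit [LocallyCompactSpace W] [TotallyDisconnectedSpace W] in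
theorem isClopen_coe_image {V : Set W} (hV : IsCompact V) (hVo : IsOpen V) :
    IsClopen ((↑) '' V : Set (OnePoint W)) :=
  ⟨OnePoint.isClosed_image_coe.2 ⟨hV.isClosed, hV⟩, OnePoint.isOpen_image_coe.2 hVo⟩

instance onePoint_totallyDisconnected : TotallyDisconnectedSpace (OnePoint W) := by
  have : TotallySeparatedSpace (OnePoint W) := by
    rw [totallySeparatedSpace_iff_exists_isClopen]
    have key : ∀ (x : W) (y : OnePoint W), (x : OnePoint W) ≠ y →
        ∃ U : Set (OnePoint W), IsClopen U ∧ (x : OnePoint W) ∈ U ∧ y ∈ Uᶜ := by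
      intro x y hxy
      have h1 : ((↑) : W → OnePoint W) ⁻¹' {y}ᶜ ∈ 𝓝 x :=
        (isOpen_compl_singleton.preimage OnePoint.continuous_coe).mem_nhds hxy
      obtain ⟨V, hV, hVo, hxV, hVU⟩ := exists_isCompact_isOpen_subset h1
      refine ⟨_, isClopen_coe_image hV hVo, mem_image_of_mem _ hxV, ?_⟩
      rintro ⟨z, hz, rfl⟩
      exact hVU hz rfl
    intro x y hxy
    induction x using OnePoint.rec with
    | coe x => exact key x y hxy
    | infty =>
      induction y using OnePoint.rec with
      | infty => exact absurd rfl hxy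
      | coe y =>
        obtain ⟨U, hU, hy, hx⟩ := key y _ hxy.symm
        exact ⟨Uᶜ, hU.compl, hx, by simpa using hy⟩
  infer_instance

/-- A clopen set or its complement misses `∞`, hence is a compact open subset of `W` and a finite
union of basic sets. So there are countably many clopen sets, which suffices. -/
instance onePoint_secondCountable [SecondCountableTopology W] :
    SecondCountableTopology (OnePoint W) := by
  rw [← Clopens.countable_iff_secondCountable]
  obtain ⟨U, h1⟩ : ∃ U : Finset (countableBasis W) → Set W,
      ∀ s : Set W, IsCompact s → IsOpen s → ∃ t, s = U t :=
    ⟨fun t => ⋃ b ∈ t, (b : Set W), fun s hs hso => by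
      obtain ⟨t, ht⟩ := eq_sUnion_finset_of_isTopologicalBasis_of_isCompact_open _
        (isBasis_countableBasis W) s hs hso
      refine ⟨t, ht.trans ?_⟩
      ext x
      simp⟩
  have h2 : ∀ C : Clopens (OnePoint W), ∃ p : Finset (countableBasis W) × Bool,
      (C : Set (OnePoint W)) = if p.2 then ((↑) '' (U p.1))
        else ((↑) '' (U p.1))ᶜ := by
    have key : ∀ C : Set (OnePoint W), IsClopen C → OnePoint.infty ∉ C →
        ∃ t : Finset (countableBasis W), C = (↑) '' (U t) := by
      intro C hC hi
      have h3 : (↑) '' (((↑) : W → OnePoint W) ⁻¹' C) = C := by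
        rw [image_preimage_eq_iff]
        intro z hz
        rw [← OnePoint.compl_infty]
        rintro rfl
        exact hi hz
      obtain ⟨t, ht⟩ := h1 (((↑) : W → OnePoint W) ⁻¹' C)
        ((OnePoint.isClosed_iff_of_notMem hi).1 hC.isClosed).2
        (hC.isOpen.preimage OnePoint.continuous_coe)
      exact ⟨t, by rw [← ht, h3]⟩
    intro C
    by_cases hi : OnePoint.infty ∈ (C : Set (OnePoint W))
    · obtain ⟨t, ht⟩ := key (C : Set (OnePoint W))ᶜ C.isClopen.compl (by simpa using hi)
      exact ⟨(t, false), by simp [← ht]⟩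
    · obtain ⟨t, ht⟩ := key C C.isClopen hi
      exact ⟨(t, true), by simpa using ht⟩
  choose f hf using h2
  have : Function.Injective f := fun C D h => Clopens.ext (by rw [hf C, hf D, h])
  exact this.countable

end Basic

theorem exists_clopens_subset {Z : Type u} [TopologicalSpace Z] [T2Space Z] [CompactSpace Z]
    [TotallyDisconnectedSpace Z] {x : Z} {U : Set Z} (hU : U ∈ 𝓝 x) :
    ∃ V : Clopens Z, x ∈ V ∧ (V : Set Z) ⊆ U := by
  obtain ⟨V, ⟨hxV, hV⟩, hVU⟩ := (nhds_basis_clopen x).mem_iff.1 hU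
  exact ⟨⟨V, hV⟩, hxV, hVU⟩

theorem exists_clopens_of_isClosed_subset_isOpen {Z : Type u} [TopologicalSpace Z] [T2Space Z]
    [CompactSpace Z] [TotallyDisconnectedSpace Z] {C U : Set Z} (hC : IsClosed C) (hU : IsOpen U)
    (h : C ⊆ U) : ∃ V : Clopens Z, C ⊆ V ∧ (V : Set Z) ⊆ U := by
  obtain ⟨V, hV, h1, h2⟩ := exists_clopen_of_closed_subset_open hC hU h
  exact ⟨⟨V, hV⟩, h1, h2⟩

/-! ### Back-and-forth along binary trees of clopen sets. -/

/-- A binary tree of sets: every node is the disjoint union of its two children. -/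
structure IsSetTree {Z : Type u} (S : List Bool → Set Z) : Prop where
  nil : S [] = univ
  cons : ∀ s x, x ∈ S s → ∃ b, x ∈ S (b :: s)
  anti : ∀ b s, S (b :: s) ⊆ S s
  disjoint : ∀ s x, x ∈ S (true :: s) → x ∉ S (false :: s)

namespace IsSetTree

variable {Z : Type u} {Z' : Type v} {S : List Bool → Set Z} {S' : List Bool → Set Z'}

theorem eq_of_mem (hS : IsSetTree S) {x : Z} : ∀ {s t : List Bool}, s.length = t.length →
    x ∈ S s → x ∈ S t → s = t
  | [], [], _, _, _ => rfl
  | a :: s, b :: t, h, hs, ht => by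
    have := hS.eq_of_mem (s := s) (t := t) (by simpa using h) (hS.anti _ _ hs) (hS.anti _ _ ht)
    subst this
    cases a <;> cases b
    · rfl
    · exact absurd hs (hS.disjoint _ _ ht)
    · exact absurd ht (hS.disjoint _ _ hs)
    · rfl

theorem exists_path (hS : IsSetTree S) (x : Z) : ∃ p : ℕ → List Bool,
    (∀ n, (p n).length = n) ∧ (∀ n, x ∈ S (p n)) ∧ ∀ n, ∃ b, p (n + 1) = b :: p n := by
  choose! b hb using fun s => hS.cons s x
  let p : ℕ → List Bool := fun n => Nat.rec [] (fun _ s => b s :: s) n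
  have hp : ∀ n, p (n + 1) = b (p n) :: p n := fun n => rfl
  refine ⟨p, fun n => ?_, fun n => ?_, fun n => ⟨_, hp n⟩⟩
  · induction n with
    | zero => rfl
    | succ n ih => rw [hp, List.length_cons, ih]
  · induction n with
    | zero => exact hS.nil ▸ mem_univ x
    | succ n ih => exact hp n ▸ hb _ ih

theorem exists_length_mem (hS : IsSetTree S) (x : Z) (n : ℕ) :
    ∃ s : List Bool, s.length = n ∧ x ∈ S s := by
  obtain ⟨p, h1, h2, -⟩ := hS.exists_path x
  exact ⟨p n, h1 n, h2 n⟩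

/-- Nodes of equal length are disjoint, so a point is on exactly one branch; by compactness the same
branch of `S'` has a point in all its nodes. -/
theorem exists_same_branch [TopologicalSpace Z'] [CompactSpace Z'] (hS : IsSetTree S)
    (hS' : IsSetTree S') (hc : ∀ s, IsClosed (S' s)) (hne : ∀ s, (S s).Nonempty → (S' s).Nonempty)
    (x : Z) : ∃ x', ∀ s, x ∈ S s ↔ x' ∈ S' s := by
  obtain ⟨p, hl, hx, hp⟩ := hS.exists_path x
  have h := IsCompact.nonempty_iInter_of_sequence_nonempty_isCompact_isClosed
    (fun n => S' (p n)) (fun n => by obtain ⟨b, hb⟩ := hp n; simpa [hb] using hS'.anti b (p n))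
    (fun n => hne _ ⟨x, hx n⟩) (hc _).isCompact (fun n => hc _)
  obtain ⟨x', hx'⟩ := h
  rw [mem_iInter] at hx'
  refine ⟨x', fun s => ⟨fun h => ?_, fun h => ?_⟩⟩
  · rw [hS.eq_of_mem (hl s.length).symm h (hx _)]; exact hx' _
  · rw [hS'.eq_of_mem (hl s.length).symm h (hx' _)]; exact hx _

end IsSetTree

variable {Z : Type u} {Z' : Type v} [TopologicalSpace Z] [TopologicalSpace Z']
  [T2Space Z] [CompactSpace Z] [TotallyDisconnectedSpace Z] [SecondCountableTopology Z]
  [T2Space Z'] [CompactSpace Z'] [TotallyDisconnectedSpace Z'] [SecondCountableTopology Z']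

/-- Back-and-forth: a relation between clopen sets that survives splitting either side yields a
homeomorphism, all of whose germs are related. -/
theorem exists_homeomorph_of_splitting (R : Clopens Z → Clopens Z' → Prop) (htop : R ⊤ ⊤)
    (hbot : ∀ A A', R A A' → (A = ⊥ ↔ A' = ⊥))
    (forth : ∀ A A', R A A' → ∀ C, ∃ C', R (A ⊓ C) (A' ⊓ C') ∧ R (A \ C) (A' \ C'))
    (back : ∀ A A', R A A' → ∀ C', ∃ C, R (A ⊓ C) (A' ⊓ C') ∧ R (A \ C) (A' \ C')) :
    ∃ f : Z ≃ₜ Z', ∀ x, ∀ V' : Clopens Z', f x ∈ V' →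
      ∃ A A', R A A' ∧ x ∈ A ∧ f x ∈ A' ∧ A' ≤ V' := by
  have hcZ : Countable (Clopens Z) := Clopens.countable_iff_secondCountable.2 inferInstance
  have hcZ' : Countable (Clopens Z') := Clopens.countable_iff_secondCountable.2 inferInstance
  obtain ⟨e, he⟩ := exists_surjective_nat (Clopens Z ⊕ Clopens Z')
  -- The request `c` is obeyed on its own side; `forth` or `back` answers on the other.
  have hstep : ∀ (p : {p : Clopens Z × Clopens Z' // R p.1 p.2}) (c : Clopens Z ⊕ Clopens Z'),
      ∃ d : Clopens Z × Clopens Z', R (p.1.1 ⊓ d.1) (p.1.2 ⊓ d.2) ∧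
        R (p.1.1 \ d.1) (p.1.2 \ d.2) ∧ (∀ C, c = .inl C → d.1 = C) ∧
        (∀ C', c = .inr C' → d.2 = C') := by
    rintro ⟨⟨A, A'⟩, hA⟩ (C | C')
    · obtain ⟨C', h1, h2⟩ := forth A A' hA C
      exact ⟨(C, C'), h1, h2, by simp, by simp⟩
    · obtain ⟨C, h1, h2⟩ := back A A' hA C'
      exact ⟨(C, C'), h1, h2, by simp, by simp⟩
  choose d hd1 hd2 hdl hdr using hstep
  -- All nodes of length `n` are split by the `n`-th clopen set of the enumeration, so every clopen
  -- set of either space is decided at some level.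
  let T : List Bool → {p : Clopens Z × Clopens Z' // R p.1 p.2} := fun s =>
    List.rec ⟨(⊤, ⊤), htop⟩ (fun b s p => Bool.rec
      ⟨(p.1.1 \ (d p (e s.length)).1, p.1.2 \ (d p (e s.length)).2), hd2 _ _⟩
      ⟨(p.1.1 ⊓ (d p (e s.length)).1, p.1.2 ⊓ (d p (e s.length)).2), hd1 _ _⟩ b) s
  have hTt : ∀ s, (T (true :: s)).1 = ((T s).1.1 ⊓ (d (T s) (e s.length)).1,
    (T s).1.2 ⊓ (d (T s) (e s.length)).2) := fun s => rfl
  have hTf : ∀ s, (T (false :: s)).1 = ((T s).1.1 \ (d (T s) (e s.length)).1,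
    (T s).1.2 \ (d (T s) (e s.length)).2) := fun s => rfl
  have hS : IsSetTree (fun s => ((T s).1.1 : Set Z)) := by
    refine ⟨rfl, fun s x hx => ?_, fun b s x hx => ?_, fun s x h1 h2 => ?_⟩
    · by_cases h : x ∈ (d (T s) (e s.length)).1
      · exact ⟨true, hx, h⟩
      · exact ⟨false, hx, h⟩
    · cases b <;> exact hx.1
    · exact h2.2 h1.2
  have hS' : IsSetTree (fun s => ((T s).1.2 : Set Z')) := by
    refine ⟨rfl, fun s x hx => ?_, fun b s x hx => ?_, fun s x h1 h2 => ?_⟩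
    · by_cases h : x ∈ (d (T s) (e s.length)).2
      · exact ⟨true, hx, h⟩
      · exact ⟨false, hx, h⟩
    · cases b <;> exact hx.1
    · exact h2.2 h1.2
  have hne : ∀ s, ((T s).1.1 : Set Z).Nonempty ↔ ((T s).1.2 : Set Z').Nonempty := by
    intro s
    have := hbot _ _ (T s).2
    rw [nonempty_iff_ne_empty, nonempty_iff_ne_empty, ne_eq, ne_eq, not_iff_not,
      ← Clopens.coe_bot, ← Clopens.coe_bot, SetLike.coe_set_eq, SetLike.coe_set_eq]
    exact this
  choose f hf using hS.exists_same_branch hS' (fun s => (T s).1.2.isClosed) (fun s => (hne s).1)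
  choose g hg using hS'.exists_same_branch hS (fun s => (T s).1.1.isClosed) (fun s => (hne s).2)
  -- A clopen set separating two points is used at some level, so their branches part there.
  have hinj' : ∀ x' y' : Z', (∀ s, x' ∈ (T s).1.2 ↔ y' ∈ (T s).1.2) → x' = y' := by
    intro x' y' h
    by_contra hxy
    obtain ⟨C, hC, hx, hy⟩ := exists_isClopen_of_totally_separated hxy
    obtain ⟨n, hn⟩ := he (.inr ⟨C, hC⟩)
    obtain ⟨s, rfl, hs⟩ := hS'.exists_length_mem x' n
    have h1 := hdr (T s) _ _ hn
    have h2 : x' ∈ (T (true :: s)).1.2 := ⟨hs, by rw [h1]; exact hx⟩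
    have h3 := ((h (true :: s)).1 h2).2
    rw [h1] at h3
    exact hy h3
  have hinj : ∀ x y : Z, (∀ s, x ∈ (T s).1.1 ↔ y ∈ (T s).1.1) → x = y := by
    intro x y h
    by_contra hxy
    obtain ⟨C, hC, hx, hy⟩ := exists_isClopen_of_totally_separated hxy
    obtain ⟨n, hn⟩ := he (.inl ⟨C, hC⟩)
    obtain ⟨s, rfl, hs⟩ := hS.exists_length_mem x n
    have h1 := hdl (T s) _ _ hn
    have h2 : x ∈ (T (true :: s)).1.1 := ⟨hs, by rw [h1]; exact hx⟩
    have h3 := ((h (true :: s)).1 h2).2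
    rw [h1] at h3
    exact hy h3
  let E : Z ≃ Z' := ⟨f, g, fun x => hinj _ _ fun s => (hg _ s).symm.trans (hf _ s).symm,
    fun x => hinj' _ _ fun s => (hf _ s).symm.trans (hg _ s).symm⟩
  have hloc : ∀ x, ∀ V' : Clopens Z', f x ∈ V' →
      ∃ s, x ∈ (T s).1.1 ∧ f x ∈ (T s).1.2 ∧ (T s).1.2 ≤ V' := by
    intro x V' hx
    obtain ⟨n, hn⟩ := he (.inr V')
    obtain ⟨s, rfl, hs⟩ := hS'.exists_length_mem (f x) n
    have h1 := hdr (T s) _ _ hn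
    have h2 : f x ∈ (T (true :: s)).1.2 := ⟨hs, by rw [h1]; exact hx⟩
    refine ⟨true :: s, (hf x (true :: s)).2 h2, h2, ?_⟩
    rw [hTt, h1]
    exact inf_le_right
  have hcont : Continuous E := by
    rw [continuous_iff_continuousAt]
    intro x U hU
    obtain ⟨V', hxV', hV'⟩ := exists_clopens_subset hU
    obtain ⟨s, h1, -, h3⟩ := hloc x V' hxV'
    rw [mem_map]
    refine mem_of_superset ((T s).1.1.isOpen.mem_nhds h1) fun y hy => ?_
    have h4 : f y ∈ (T s).1.2 := (hf y s).1 hy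
    exact hV' (h3 h4)
  refine ⟨hcont.homeoOfEquivCompactToT2, fun x V' hx => ?_⟩
  obtain ⟨s, h1, h2, h3⟩ := hloc x V' hx
  exact ⟨_, _, (T s).2, h1, h2, h3⟩

/-! ### Height functions. -/

/-- `h` is a height function relative to the closed set `K`: near each point, every other point off
`K` has smaller height, and every smaller height is attained off `K` arbitrarily close by. -/
structure IsHeight {Z : Type u} [TopologicalSpace Z] (K : Set Z) (h : Z → Ordinal.{0}) : Prop where
  isClosed : IsClosed K
  lt : ∀ x, ∀ᶠ y in 𝓝[≠] x, y ∉ K → h y < h x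
  freq : ∀ x, ∀ ζ < h x, ∃ᶠ y in 𝓝[≠] x, y ∉ K ∧ h y = ζ

/-- The points of `A` off `K` at height `ξ`. -/
def layer {Z : Type u} (K : Set Z) (h : Z → Ordinal.{0}) (A : Set Z) (ξ : Ordinal.{0}) : Set Z :=
  {x ∈ A | x ∉ K ∧ h x = ξ}

theorem encard_layer_add {Z : Type u} (K : Set Z) (h : Z → Ordinal.{0}) {A Q : Set Z} (hQ : Q ⊆ A)
    (ξ : Ordinal.{0}) :
    (layer K h (A \ Q) ξ).encard + (layer K h Q ξ).encard = (layer K h A ξ).encard := by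
  rw [← encard_union_eq]
  · congr 1
    ext x
    constructor
    · rintro (hx | hx)
      · exact ⟨hx.1.1, hx.2⟩
      · exact ⟨hQ hx.1, hx.2⟩
    · intro hx
      by_cases hxQ : x ∈ Q
      · exact Or.inr ⟨hxQ, hx.2⟩
      · exact Or.inl ⟨⟨hx.1, hxQ⟩, hx.2⟩
  · exact disjoint_left.2 fun x h1 h2 => h1.1.2 h2.1

namespace IsHeight

variable {Z : Type u} [TopologicalSpace Z] {K : Set Z} {h : Z → Ordinal.{0}}

theorem eventually_lt (H : IsHeight K h) (x : Z) : ∀ᶠ y in 𝓝 x, y ≠ x → y ∉ K → h y < h x :=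
  eventually_nhdsWithin_iff.1 (H.lt x)

theorem exists_mem (H : IsHeight K h) {x : Z} {ζ : Ordinal.{0}} (hζ : ζ < h x) {U : Set Z}
    (hU : U ∈ 𝓝 x) : ∃ y ∈ U, y ≠ x ∧ y ∉ K ∧ h y = ζ := by
  obtain ⟨y, ⟨h1, h2⟩, h3⟩ :=
    (frequently_nhdsWithin_iff.1 (H.freq x ζ hζ)).and_eventually hU |>.exists
  exact ⟨y, h3, h2, h1⟩

/-- If `h y > h x` with `y` near `x`, then the height `h x` is attained off `K` near `y` at a point
other than `x`, against `lt` at `x`. Unlike `lt`, this also controls nearby points of `K`. -/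
theorem eventually_le [T1Space Z] (H : IsHeight K h) (x : Z) : ∀ᶠ y in 𝓝 x, h y ≤ h x := by
  filter_upwards [(H.eventually_lt x).eventually_nhds] with y hy
  by_contra! hlt
  have hne : y ≠ x := by rintro rfl; exact lt_irrefl _ hlt
  obtain ⟨z, hz, -, hzK, hzx⟩ := H.exists_mem hlt
    (inter_mem hy (isOpen_compl_singleton.mem_nhds hne))
  exact (hz.1 hz.2 hzK).ne hzx

theorem infinite_layer [T1Space Z] (H : IsHeight K h) {A : Set Z} (hA : IsOpen A) {x : Z}
    (hx : x ∈ A) {ζ : Ordinal.{0}} (hζ : ζ < h x) : (layer K h A ζ).Infinite := by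
  intro hfin
  have h1 : (layer K h A ζ \ {x})ᶜ ∈ 𝓝 x :=
    (hfin.subset sdiff_subset).isClosed.isOpen_compl.mem_nhds (by simp)
  obtain ⟨y, hy, hyx, hyK, hyζ⟩ := H.exists_mem hζ (inter_mem (hA.mem_nhds hx) h1)
  exact hy.2 ⟨⟨hy.1, hyK, hyζ⟩, hyx⟩

/-- An accumulation point of the layer is strictly higher. Consequently the layer at the maximal
height of a compact set is finite. -/
theorem exists_lt_of_infinite_layer (H : IsHeight K h) {A : Set Z} (hA : IsCompact A)
    {ζ : Ordinal.{0}} (hinf : (layer K h A ζ).Infinite) : ∃ x ∈ A, ζ < h x := by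
  obtain ⟨x, hx, hacc⟩ := hinf.exists_accPt_of_subset_isCompact hA fun y hy => hy.1
  obtain ⟨y, hy, hlt⟩ := (accPt_iff_frequently_nhdsNE.1 hacc).and_eventually (H.lt x) |>.exists
  exact ⟨x, hx, hy.2.2 ▸ hlt hy.2.1⟩

theorem exists_max [T1Space Z] (H : IsHeight K h) {A : Set Z} (hA : IsCompact A)
    (hne : A.Nonempty) : ∃ x ∈ A, ∀ y ∈ A, h y ≤ h x := by
  have : UpperSemicontinuous h := fun x ξ hξ =>
    (H.eventually_le x).mono fun y hy => hy.trans_lt hξ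
  exact (this.upperSemicontinuousOn A).exists_isMaxOn hne hA

variable [T2Space Z] [CompactSpace Z] [TotallyDisconnectedSpace Z]

theorem exists_isolating (H : IsHeight K h) (A : Clopens Z) {τ : Ordinal.{0}} {F : Set Z}
    (hF : F.Finite) (hFA : F ⊆ layer K h A τ) :
    ∃ B : Clopens Z, B ≤ A ∧ F ⊆ B ∧ (∀ y ∈ B, y ∉ K) ∧ ∀ y ∈ B, y ∉ F → h y < τ := by
  obtain ⟨B, h1, h2⟩ := exists_clopens_of_isClosed_subset_isOpen hF.isClosed
    (isOpen_interior (s := {y | y ∈ A ∧ y ∉ K ∧ (y ∉ F → h y < τ)})) (by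
      intro x hx
      rw [mem_interior_iff_mem_nhds]
      filter_upwards [A.isOpen.mem_nhds (hFA hx).1, H.isClosed.isOpen_compl.mem_nhds (hFA hx).2.1,
        H.eventually_lt x] with y hyA hyK hlt
      refine ⟨hyA, hyK, fun hyF => ?_⟩
      rw [← (hFA hx).2.2]
      exact hlt (by rintro rfl; exact hyF hx) hyK)
  have h3 : ∀ y ∈ B, y ∈ A ∧ y ∉ K ∧ (y ∉ F → h y < τ) := fun y hy =>
    interior_subset (s := {y | y ∈ A ∧ y ∉ K ∧ (y ∉ F → h y < τ)}) (h2 hy)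
  exact ⟨B, fun y hy => (h3 y hy).1, h1, fun y hy => (h3 y hy).2.1, fun y hy => (h3 y hy).2.2⟩

/-- The bound on the kernel points of `A` prevents points off `K` of height at least `τ` from
accumulating on `K`; they form a closed set, which a clopen set missing `K` can enclose. -/
theorem exists_clopen_cover (H : IsHeight K h) (A : Clopens Z) {τ : Ordinal.{0}}
    (hA : ∀ x ∈ A, x ∈ K → h x ≤ τ) :
    ∃ B : Clopens Z, B ≤ A ∧ (∀ y ∈ B, y ∉ K) ∧ ∀ y ∈ A, y ∉ B → y ∉ K → h y < τ := by
  have hC : IsClosed {y | y ∈ A ∧ y ∉ K ∧ τ ≤ h y} := by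
    rw [← isOpen_compl_iff, isOpen_iff_mem_nhds]
    intro x hx
    by_cases hxA : x ∈ A
    · by_cases hxK : x ∈ K
      · filter_upwards [H.eventually_lt x] with y hy hyC
        exact (hy (by rintro rfl; exact hyC.2.1 hxK) hyC.2.1).not_ge ((hA x hxA hxK).trans hyC.2.2)
      · have hlt : h x < τ := lt_of_not_ge fun hle => hx ⟨hxA, hxK, hle⟩
        filter_upwards [H.eventually_le x] with y hy hyC
        exact (hy.trans_lt hlt).not_ge hyC.2.2
    · filter_upwards [A.isClosed.isOpen_compl.mem_nhds hxA] with y hy hyC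
      exact hy hyC.1
  obtain ⟨B, h1, h2⟩ := exists_clopens_of_isClosed_subset_isOpen hC
    (A.isOpen.inter H.isClosed.isOpen_compl) fun y hy => ⟨hy.1, hy.2.1⟩
  refine ⟨B, fun y hy => (h2 hy).1, fun y hy => (h2 hy).2, fun y hy hyB hyK => ?_⟩
  by_contra! hle
  exact hyB (h1 ⟨hy, hyK, hle⟩)

end IsHeight

/-! ### Extending a homeomorphism of kernels. -/

section Extension

variable {Z : Type u} {Z' : Type v} [TopologicalSpace Z] [TopologicalSpace Z']
  {K : Set Z} {h : Z → Ordinal.{0}} {K' : Set Z'} {h' : Z' → Ordinal.{0}}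

/-- `A` and `A'` have the same trace on the kernels and layers of equal cardinality. -/
def Matched (φ : K ≃ₜ K') (h : Z → Ordinal.{0}) (h' : Z' → Ordinal.{0}) (A : Clopens Z)
    (A' : Clopens Z') : Prop :=
  (∀ x : K, (x : Z) ∈ A ↔ (φ x : Z') ∈ A') ∧
    ∀ ξ, (layer K h A ξ).encard = (layer K' h' A' ξ).encard

theorem Matched.symm {φ : K ≃ₜ K'} {A : Clopens Z} {A' : Clopens Z'} (hA : Matched φ h h' A A') :
    Matched φ.symm h' h A' A :=
  ⟨fun x => by rw [hA.1, φ.apply_symm_apply], fun ξ => (hA.2 ξ).symm⟩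

theorem matched_bot (φ : K ≃ₜ K') : Matched φ h h' ⊥ ⊥ :=
  ⟨fun x => Iff.rfl, fun ξ => by simp [layer]⟩

theorem Matched.eq_bot {φ : K ≃ₜ K'} {A' : Clopens Z'} (hA : Matched φ h h' ⊥ A') : A' = ⊥ := by
  refine Clopens.ext (eq_empty_of_forall_notMem fun y hy => ?_)
  by_cases hyK : y ∈ K'
  · have := (hA.1 (φ.symm ⟨y, hyK⟩)).2 (by simpa using hy)
    exact this
  · have h1 := hA.2 (h' y)
    have h2 : layer K h ((⊥ : Clopens Z) : Set Z) (h' y) = ∅ := by simp [layer]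
    rw [h2, encard_empty] at h1
    have h3 : y ∈ layer K' h' A' (h' y) := ⟨hy, hyK, rfl⟩
    rw [encard_eq_zero.1 h1.symm] at h3
    exact h3

variable [T2Space Z] [CompactSpace Z] [TotallyDisconnectedSpace Z]
  [T2Space Z'] [CompactSpace Z'] [TotallyDisconnectedSpace Z']

omit [T2Space Z] [CompactSpace Z] [TotallyDisconnectedSpace Z] in
theorem exists_clopens_trace (hK : IsClosed K') (φ : K ≃ₜ K') (C : Clopens Z) :
    ∃ C' : Clopens Z', ∀ x : K, (x : Z) ∈ C ↔ (φ x : Z') ∈ C' := by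
  have key : ∀ D : Clopens Z, IsClosed ((↑) '' (φ '' ((↑) ⁻¹' (D : Set Z))) : Set Z') := fun D =>
    hK.isClosedEmbedding_subtypeVal.isClosedMap _
      (φ.isClosedMap _ (D.isClosed.preimage continuous_subtype_val))
  obtain ⟨C', h1, h2⟩ := exists_clopens_of_isClosed_subset_isOpen (key C) (key Cᶜ).isOpen_compl (by
    rintro _ ⟨_, ⟨x, hx, rfl⟩, rfl⟩ ⟨_, ⟨y, hy, rfl⟩, hxy⟩
    have : y = x := φ.injective (Subtype.ext hxy)
    exact hy (this ▸ hx))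
  refine ⟨C', fun x => ⟨fun hx => h1 ⟨_, ⟨x, hx, rfl⟩, rfl⟩, fun hx => ?_⟩⟩
  by_contra hxC
  exact h2 hx ⟨_, ⟨x, hxC, rfl⟩, rfl⟩

-- Below the maximal height `h q` of `Q` all layers are infinite, in `Q` and, because of `p`, in `A
-- \ Q`. So only the finite top layer of `Q` has to be counted, and the rest of the matching for `A
-- \ Q` follows by cancellation.
omit [T2Space Z] in
theorem Matched.split_aux (H : IsHeight K h) (H' : IsHeight K' h') {φ : K ≃ₜ K'}
    (hφ : ∀ x : K, h' (φ x) = h x) {A Q : Clopens Z} {A' : Clopens Z'}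
    (hA : Matched φ h h' A A') (hQA : Q ≤ A) {q p : Z} (hq : q ∈ Q) (hqmax : ∀ y ∈ Q, h y ≤ h q)
    (hpA : p ∈ A) (hpQ : p ∉ Q) (hqp : h q ≤ h p) :
    ∃ Q', Q' ≤ A' ∧ Matched φ h h' Q Q' ∧ Matched φ h h' (A \ Q) (A' \ Q') := by
  obtain ⟨C', hC'⟩ := exists_clopens_trace H'.isClosed φ Q
  have hQ0 : ∀ x : K, (x : Z) ∈ Q ↔ (φ x : Z') ∈ A' ⊓ C' := fun x =>
    ⟨fun hx => ⟨(hA.1 x).1 (hQA hx), (hC' x).1 hx⟩, fun hx => (hC' x).2 hx.2⟩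
  obtain ⟨B₀, hB₀, hB₀K, hB₀lt⟩ := H'.exists_clopen_cover (A' ⊓ C') (τ := h q) (by
    intro x hx hxK
    have h1 := hφ (φ.symm ⟨x, hxK⟩)
    rw [φ.apply_symm_apply] at h1
    rw [h1]
    exact hqmax _ ((hQ0 _).2 (by simpa using hx)))
  -- `Q₁` has the right trace on the kernel, but everything off the kernel at height `h q` or more
  -- has been removed.
  set Q₁ := (A' ⊓ C') \ B₀ with hQ₁
  have hQ₁A : Q₁ ≤ A' := fun y hy => hy.1.1
  have hQ₁lt : ∀ y ∈ Q₁, y ∉ K' → h' y < h q := fun y hy => hB₀lt y hy.1 hy.2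
  have hfin : (layer K h Q (h q)).Finite := by
    by_contra hinf
    obtain ⟨x, hx, hlt⟩ := H.exists_lt_of_infinite_layer Q.isClosed.isCompact hinf
    exact hlt.not_ge (hqmax x hx)
  have hle : (layer K h Q (h q)).encard ≤ (layer K' h' (A' \ Q₁ : Clopens Z') (h q)).encard := by
    have h1 : layer K' h' (A' \ Q₁ : Clopens Z') (h q) = layer K' h' A' (h q) := by
      ext y
      refine ⟨fun hy => ⟨hy.1.1, hy.2⟩, fun hy => ⟨⟨hy.1, fun hy1 => ?_⟩, hy.2⟩⟩
      exact (hQ₁lt y hy1 hy.2.1).ne hy.2.2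
    rw [h1, ← hA.2]
    exact encard_le_encard fun y hy => ⟨hQA hy.1, hy.2⟩
  -- `F` restores exactly as many points of height `h q` as `Q` has; `B` isolates them from the
  -- kernel and from other points of height `h q` or more.
  obtain ⟨F, hF, hFcard⟩ := exists_subset_encard_eq hle
  have hFfin : F.Finite := by
    rw [← encard_lt_top_iff, hFcard]
    exact hfin.encard_lt_top
  obtain ⟨B, hBA, hFB, hBK, hBlt⟩ := H'.exists_isolating _ hFfin hF
  have hQ'K : ∀ x : K, (x : Z) ∈ Q ↔ (φ x : Z') ∈ Q₁ ⊔ B := by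
    intro x
    rw [hQ0]
    refine ⟨fun hx => Or.inl ⟨hx, fun hxB => hB₀K _ hxB (φ x).2⟩, ?_⟩
    rintro (hx | hx)
    · exact hx.1
    · exact absurd (φ x).2 (hBK _ hx)
  have hQ'A : Q₁ ⊔ B ≤ A' := sup_le hQ₁A fun y hy => (hBA hy).1
  have hQ'lt : ∀ y ∈ Q₁ ⊔ B, y ∉ K' → y ∈ F ∨ h' y < h q := by
    rintro y (hy | hy) hyK
    · exact Or.inr (hQ₁lt y hy hyK)
    · by_cases hyF : y ∈ F
      · exact Or.inl hyF
      · exact Or.inr (hBlt y hy hyF)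
  have hlayer : ∀ ξ, (layer K h Q ξ).encard = (layer K' h' (Q₁ ⊔ B : Clopens Z') ξ).encard := by
    intro ξ
    rcases lt_trichotomy ξ (h q) with hlt | rfl | hlt
    -- A point of height `h q` on the primed side makes all lower layers infinite there: `φ q` if
    -- `q` is in the kernel, otherwise a point of `F`.
    · have h1 : ∃ y ∈ Q₁ ⊔ B, h' y = h q := by
        by_cases hqK : q ∈ K
        · exact ⟨φ ⟨q, hqK⟩, (hQ'K ⟨q, hqK⟩).1 hq, hφ _⟩
        · have h2 : F.Nonempty := by
            rw [← encard_ne_zero, hFcard, encard_ne_zero]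
            exact ⟨q, hq, hqK, rfl⟩
          obtain ⟨y, hy⟩ := h2
          exact ⟨y, Or.inr (hFB hy), (hF hy).2.2⟩
      obtain ⟨y, hy, hyq⟩ := h1
      rw [(H.infinite_layer Q.isOpen hq hlt).encard_eq,
        (H'.infinite_layer (Q₁ ⊔ B).isOpen hy (hyq ▸ hlt)).encard_eq]
    · rw [← hFcard]
      congr 1
      ext y
      refine ⟨fun hy => ⟨Or.inr (hFB hy), (hF hy).2⟩, fun hy => ?_⟩
      exact (hQ'lt y hy.1 hy.2.1).resolve_right hy.2.2.not_lt
    · have h1 : layer K h Q ξ = ∅ := eq_empty_of_forall_notMem fun y hy =>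
        (hy.2.2 ▸ hqmax y hy.1).not_gt hlt
      have h2 : layer K' h' (Q₁ ⊔ B : Clopens Z') ξ = ∅ := eq_empty_of_forall_notMem fun y hy => by
        rcases hQ'lt y hy.1 hy.2.1 with hyF | hylt
        · exact hlt.ne ((hF hyF).2.2.symm.trans hy.2.2)
        · exact (hlt.trans (hy.2.2 ▸ hylt)).false
      rw [h1, h2, encard_empty, encard_empty]
  have hPK : ∀ x : K, (x : Z) ∈ A \ Q ↔ (φ x : Z') ∈ A' \ (Q₁ ⊔ B) := fun x =>
    and_congr (hA.1 x) (not_congr (hQ'K x))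
  have hPge : ∀ ξ, h q ≤ ξ → (layer K h (A \ Q : Clopens Z) ξ).encard =
      (layer K' h' (A' \ (Q₁ ⊔ B) : Clopens Z') ξ).encard := by
    intro ξ hξ
    have hne : (layer K h Q ξ).encard ≠ ⊤ := by
      rw [encard_ne_top_iff]
      by_contra hinf
      obtain ⟨x, hx, hlt⟩ := H.exists_lt_of_infinite_layer Q.isClosed.isCompact hinf
      exact (hξ.trans_lt hlt).not_ge (hqmax x hx)
    have h1 := encard_layer_add K h hQA ξ
    have h2 := encard_layer_add K' h' hQ'A ξ
    rw [hA.2, ← h2, ← hlayer] at h1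
    -- Cancellation is legitimate because layers of `Q` at heights `ξ ≥ h q` are finite.
    exact WithTop.add_right_cancel hne h1
  refine ⟨Q₁ ⊔ B, hQ'A, ⟨hQ'K, hlayer⟩, hPK, fun ξ => ?_⟩
  rcases le_or_gt (h q) ξ with hle | hlt
  · exact hPge ξ hle
  · have h1 : ∃ y ∈ A' \ (Q₁ ⊔ B), h' y = h p := by
      by_cases hpK : p ∈ K
      · exact ⟨φ ⟨p, hpK⟩, (hPK ⟨p, hpK⟩).1 ⟨hpA, hpQ⟩, hφ _⟩
      · have h2 := hPge (h p) hqp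
        have h3 : (layer K' h' (A' \ (Q₁ ⊔ B) : Clopens Z') (h p)).Nonempty := by
          rw [← encard_ne_zero, ← h2, encard_ne_zero]
          exact ⟨p, ⟨hpA, hpQ⟩, hpK, rfl⟩
        obtain ⟨y, hy⟩ := h3
        exact ⟨y, hy.1, hy.2.2⟩
    obtain ⟨y, hy, hyp⟩ := h1
    rw [(H.infinite_layer (A \ Q).isOpen ⟨hpA, hpQ⟩ (hlt.trans_le hqp)).encard_eq,
      (H'.infinite_layer (A' \ (Q₁ ⊔ B)).isOpen hy (hyp ▸ hlt.trans_le hqp)).encard_eq]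

-- The piece with the smaller maximal height takes the role of `Q` in `Matched.split_aux`.
omit [T2Space Z] in
theorem Matched.split (H : IsHeight K h) (H' : IsHeight K' h') {φ : K ≃ₜ K'}
    (hφ : ∀ x : K, h' (φ x) = h x) {A : Clopens Z} {A' : Clopens Z'}
    (hA : Matched φ h h' A A') (C : Clopens Z) :
    ∃ C', Matched φ h h' (A ⊓ C) (A' ⊓ C') ∧ Matched φ h h' (A \ C) (A' \ C') := by
  rcases eq_or_ne (A ⊓ C) ⊥ with h0 | h0
  · refine ⟨⊥, ?_, ?_⟩
    · rw [h0, inf_bot_eq]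
      exact matched_bot φ
    · rwa [sdiff_bot, (disjoint_iff.2 h0).sdiff_eq_left]
  rcases eq_or_ne (A \ C) ⊥ with h1 | h1
  · refine ⟨⊤, ?_, ?_⟩
    · rwa [inf_top_eq, inf_eq_left.2 (sdiff_eq_bot_iff.1 h1)]
    · rw [h1, sdiff_top]
      exact matched_bot φ
  have hne : ∀ D : Clopens Z, D ≠ ⊥ → ∃ x ∈ D, ∀ y ∈ D, h y ≤ h x := fun D hD =>
    H.exists_max D.isClosed.isCompact (nonempty_iff_ne_empty.2 fun he => hD (Clopens.ext he))
  obtain ⟨q, hq, hqmax⟩ := hne _ h0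
  obtain ⟨p, hp, hpmax⟩ := hne _ h1
  rcases le_total (h q) (h p) with hle | hle
  · obtain ⟨Q', hQ', h2, h3⟩ := hA.split_aux H H' hφ (Q := A ⊓ C) inf_le_left hq hqmax hp.1
      (fun hp' => hp.2 hp'.2) hle
    refine ⟨Q', by rwa [inf_eq_right.2 hQ'], by rwa [sdiff_inf_self_left] at h3⟩
  · obtain ⟨Q', hQ', h2, h3⟩ := hA.split_aux H H' hφ (Q := A \ C) sdiff_le hp hpmax hq.1
      (fun hq' => hq'.2 hq.2) hle
    refine ⟨Q'ᶜ, by rwa [← _root_.sdiff_eq, ← _root_.sdiff_sdiff_right_self], ?_⟩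
    rwa [_root_.sdiff_compl, inf_eq_right.2 hQ']

/-- An isomorphism between the kernels of two compact spaces with height functions extends to a
homeomorphism as soon as the layers have equal cardinality. -/
theorem exists_homeomorph_extending [SecondCountableTopology Z] [SecondCountableTopology Z']
    (H : IsHeight K h) (H' : IsHeight K' h') (φ : K ≃ₜ K') (hφ : ∀ x : K, h' (φ x) = h x)
    (hlayer : ∀ ξ, (layer K h univ ξ).encard = (layer K' h' univ ξ).encard) :
    ∃ f : Z ≃ₜ Z', ∀ x : K, f x = φ x := by
  have hφ' : ∀ x : K', h (φ.symm x) = h' x := fun x => by rw [← hφ, φ.apply_symm_apply]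
  obtain ⟨f, hf⟩ := exists_homeomorph_of_splitting (Matched φ h h')
    ⟨fun x => ⟨fun _ => mem_univ _, fun _ => mem_univ _⟩, hlayer⟩
    (fun A A' hA => ⟨by rintro rfl; exact hA.eq_bot, by rintro rfl; exact hA.symm.eq_bot⟩)
    (fun A A' hA C => hA.split H H' hφ C) (fun A A' hA C' => by
      obtain ⟨C, h1, h2⟩ := hA.symm.split H' H hφ' C'
      exact ⟨C, h1.symm, h2.symm⟩)
  refine ⟨f, fun x => ?_⟩
  by_contra hne
  obtain ⟨V, hV, hx, hx'⟩ := exists_isClopen_of_totally_separated hne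
  obtain ⟨A, A', hA, hxA, -, hAV⟩ := hf x ⟨V, hV⟩ hx
  exact hx' (hAV ((hA.1 x).1 hxA))

end Extension

/-! ### The Cantor-Bendixson sequence and its height function. -/

section CantorBendixson

variable {W : Type u} [TopologicalSpace W]

theorem isClosed_cb_and_antitone [T1Space W] (η : Ordinal.{0}) :
    IsClosed (cb W η) ∧ ∀ ξ ≤ η, cb W η ⊆ cb W ξ := by
  induction η using Ordinal.limitRecOn with
  | zero =>
    refine ⟨by rw [cb_zero]; exact isClosed_univ, fun ξ hξ => ?_⟩
    rw [nonpos_iff_eq_zero.1 hξ]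
  | add_one η ih =>
    rw [cb_succ]
    refine ⟨isClosed_derivedSet _, fun ξ hξ => ?_⟩
    rcases hξ.eq_or_lt with rfl | hlt
    · rw [cb_succ]
    · exact ((isClosed_iff_derivedSet_subset _).1 ih.1).trans (ih.2 ξ (Order.lt_add_one_iff.1 hlt))
  | limit η hη ih =>
    rw [cb_limit W η hη]
    refine ⟨isClosed_iInter fun ζ => isClosed_iInter fun hζ => (ih ζ hζ).1, fun ξ hξ => ?_⟩
    rcases hξ.eq_or_lt with rfl | hlt
    · rw [cb_limit W ξ hη]
    · exact iInter₂_subset ξ hlt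

theorem isClosed_cb [T1Space W] (η : Ordinal.{0}) : IsClosed (cb W η) :=
  (isClosed_cb_and_antitone η).1

theorem cb_antitone [T1Space W] : Antitone (cb W) := fun _ η h =>
  (isClosed_cb_and_antitone η).2 _ h

/-- Treats zero, successor and limit stages alike, so later inductions need no case distinction. -/
theorem mem_cb_iff [T1Space W] {x : W} {η : Ordinal.{0}} :
    x ∈ cb W η ↔ ∀ ζ < η, x ∈ cb W (ζ + 1) := by
  refine ⟨fun hx ζ hζ => cb_antitone (Order.add_one_le_of_lt hζ) hx, fun hx => ?_⟩
  induction η using Ordinal.limitRecOn with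
  | zero => rw [cb_zero]; exact mem_univ x
  | add_one η ih => exact hx η (Order.lt_add_one_iff.2 le_rfl)
  | limit η hη ih =>
    rw [cb_limit W η hη]
    exact mem_iInter₂.2 fun ζ hζ => cb_antitone (le_self_add) (hx ζ hζ)

theorem not_countable_Iio_omega_one : ¬ Countable (Iio (ω₁ : Ordinal.{0})) := by
  intro hc
  have h := Ordinal.iSup_lt_omega_one (f := fun ξ : Iio (ω₁ : Ordinal.{0}) => (ξ : Ordinal.{0}) + 1)
    fun ξ => (Cardinal.isSuccLimit_omega 1).add_one_lt ξ.2
  have hb : BddAbove (range fun ξ : Iio (ω₁ : Ordinal.{0}) => (ξ : Ordinal.{0}) + 1) :=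
    ⟨ω₁, by rintro _ ⟨ξ, rfl⟩; exact Order.add_one_le_of_lt ξ.2⟩
  have h2 := le_ciSup hb ⟨_, h⟩
  exact (Order.lt_add_one_iff.2 le_rfl).not_ge h2

variable [T1Space W] [SecondCountableTopology W]

-- Each strict step loses a point isolated in its level by some basic open set. These sets are
-- distinct for distinct steps, and a countable base cannot accommodate `ω₁` of them.
variable (W) in
theorem exists_cb_eq : ∃ ξ < ω₁, cb W ξ = cb W (ξ + 1) := by
  by_contra! hne
  have key : ∀ ξ : Iio (ω₁ : Ordinal.{0}), ∃ (b : countableBasis W) (x : W), x ∈ cb W ξ ∧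
      x ∈ (b : Set W) ∧ ∀ y ∈ (b : Set W), y ∈ cb W ξ → y = x := by
    intro ξ
    have h1 : ¬ cb W ξ ⊆ cb W (ξ + 1) := fun h =>
      hne ξ ξ.2 (h.antisymm (cb_antitone (le_self_add)))
    obtain ⟨x, hx, hx'⟩ := not_subset.1 h1
    rw [cb_succ, mem_derivedSet, accPt_iff_nhds] at hx'
    push Not at hx'
    obtain ⟨U, hU, hUx⟩ := hx'
    obtain ⟨b, hb, hxb, hbU⟩ := (isBasis_countableBasis W).mem_nhds_iff.1 hU
    exact ⟨⟨b, hb⟩, x, hx, hxb, fun y hy hyc => hUx y ⟨hbU hy, hyc⟩⟩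
  choose b x hx hxb hb using key
  have hlt : ∀ ξ η : Iio (ω₁ : Ordinal.{0}), (ξ : Ordinal.{0}) < η → b ξ ≠ b η := by
    intro ξ η hlt hbe
    have h1 : x η = x ξ := hb ξ _ (hbe ▸ hxb η) (cb_antitone hlt.le (hx η))
    have h2 : x ξ ∈ cb W (ξ + 1) := h1 ▸ cb_antitone (Order.add_one_le_of_lt hlt) (hx η)
    rw [cb_succ, mem_derivedSet, accPt_iff_nhds] at h2
    obtain ⟨y, hy, hyx⟩ := h2 _ ((isOpen_of_mem_countableBasis (b ξ).2).mem_nhds (hxb ξ))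
    exact hyx (hb ξ y hy.1 hy.2)
  have hinj : Function.Injective b := by
    intro ξ η h
    rcases lt_trichotomy (ξ : Ordinal.{0}) η with h1 | h1 | h1
    · exact absurd h (hlt _ _ h1)
    · exact Subtype.ext h1
    · exact absurd h.symm (hlt _ _ h1)
  exact not_countable_Iio_omega_one hinj.countable

variable (W) in
theorem cb_nu : cb W (nu W) = cb W (nu W + 1) := by
  obtain ⟨ξ, -, hξ⟩ := exists_cb_eq W
  exact csInf_mem (s := {ξ | cb W ξ = cb W (ξ + 1)}) ⟨ξ, hξ⟩

variable (W) in
theorem nu_lt_omega_one : nu W < ω₁ := by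
  obtain ⟨ξ, h1, hξ⟩ := exists_cb_eq W
  exact (csInf_le' (s := {ξ | cb W ξ = cb W (ξ + 1)}) hξ).trans_lt h1

variable (W) in
omit [SecondCountableTopology W] in
theorem isClosed_kernel : IsClosed (kernel W) := isClosed_cb _

variable (W) in
theorem derivedSet_kernel : derivedSet (kernel W) = kernel W := by
  rw [kernel, ← cb_succ, ← cb_nu]

variable (W) in
theorem kernel_subset_cb (ξ : Ordinal.{0}) : kernel W ⊆ cb W ξ := by
  induction ξ using WellFoundedLT.induction with
  | ind ξ ih =>
    intro x hx
    refine mem_cb_iff.2 fun ζ hζ => ?_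
    rw [cb_succ]
    rw [← derivedSet_kernel] at hx
    exact derivedSet_mono _ _ (ih ζ hζ) hx

open Classical in
variable (W) in
/-- The rank of a point of the perfect kernel, and the Cantor-Bendixson height of any other point. -/
noncomputable def cbHeight (x : W) : Ordinal.{0} :=
  if hx : x ∈ kernel W then rank W ⟨x, hx⟩ else sInf {ξ | x ∉ cb W (ξ + 1)}

omit [T1Space W] [SecondCountableTopology W] in
theorem cbHeight_coe (x : kernel W) : cbHeight W x = rank W x := by
  simp [cbHeight]

theorem le_cbHeight_iff {x : W} (hx : x ∉ kernel W) {ζ : Ordinal.{0}} :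
    ζ ≤ cbHeight W x ↔ x ∈ cb W ζ := by
  have hne : {ξ | x ∉ cb W (ξ + 1)}.Nonempty := ⟨nu W, fun h => hx (by rwa [kernel, cb_nu])⟩
  rw [cbHeight, dif_neg hx, mem_cb_iff]
  refine ⟨fun h ξ hξ => ?_, fun h => ?_⟩
  · by_contra hξx
    exact notMem_of_lt_csInf' (hξ.trans_le h) hξx
  · by_contra! hlt
    exact csInf_mem hne (h _ hlt)

theorem mem_cb_diff_kernel {x : W} {ξ : Ordinal.{0}} :
    x ∈ cb W ξ \ kernel W ↔ x ∉ kernel W ∧ ξ ≤ cbHeight W x :=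
  ⟨fun h => ⟨h.2, (le_cbHeight_iff h.2).2 h.1⟩, fun h => ⟨(le_cbHeight_iff h.1).1 h.2, h.1⟩⟩

theorem mem_cbLayer {x : W} {ξ : Ordinal.{0}} :
    x ∈ cbLayer W ξ ↔ x ∉ kernel W ∧ cbHeight W x = ξ := by
  by_cases hx : x ∈ kernel W
  · simp only [hx, not_true_eq_false, false_and, iff_false]
    exact fun h => h.2 (kernel_subset_cb W _ hx)
  · rw [cbLayer, Set.mem_sdiff, ← le_cbHeight_iff hx, ← le_cbHeight_iff hx, Order.add_one_le_iff, not_lt]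
    simp only [hx, not_false_eq_true, true_and]
    exact ⟨fun h => h.2.antisymm h.1, fun h => ⟨h.ge, h.le⟩⟩

theorem cbHeight_lt_nu {x : W} (hx : x ∉ kernel W) : cbHeight W x < nu W := by
  by_contra! h
  exact hx ((le_cbHeight_iff hx).1 h)

theorem lt_rank_iff {x : kernel W} {ζ : Ordinal.{0}} :
    ζ < (rank W x : Ordinal.{0}) ↔ (x : W) ∈ closure (cb W ζ \ kernel W) := by
  -- `ν(W) < ω₁` belongs to the set, so the infimum defining the rank is a true minimum and not the
  -- default `0`.
  have hne : {ξ : Ordinal.{0} | ξ < ω₁ ∧ (x : W) ∉ closure (cb W ξ \ kernel W)}.Nonempty :=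
    ⟨nu W, nu_lt_omega_one W, by change (x : W) ∉ closure (kernel W \ kernel W); simp⟩
  refine ⟨fun h => ?_, fun h => ?_⟩
  · by_contra hx
    exact notMem_of_lt_csInf' h ⟨h.trans (rank W x).2, hx⟩
  · by_contra! hle
    exact (csInf_mem hne).2 (closure_mono (sdiff_subset_sdiff_left (cb_antitone hle)) h)

theorem IsHeight.cbHeight : IsHeight (kernel W) (cbHeight W) := by
  have hlt : ∀ x, ∀ᶠ y in 𝓝[≠] x, y ∉ kernel W → OmegaStone.cbHeight W y < OmegaStone.cbHeight W x := by
    intro x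
    by_cases hx : x ∈ kernel W
    · have h1 : (x : W) ∉ closure (cb W (rank W ⟨x, hx⟩) \ kernel W) := fun h =>
        lt_irrefl _ (lt_rank_iff.2 h)
      filter_upwards [nhdsWithin_le_nhds (isClosed_closure.isOpen_compl.mem_nhds h1)] with y hy hyK
      by_contra! hle
      rw [cbHeight_coe ⟨x, hx⟩] at hle
      exact hy (subset_closure (mem_cb_diff_kernel.2 ⟨hyK, hle⟩))
    · have h1 : x ∉ cb W (OmegaStone.cbHeight W x + 1) := fun h =>
        (Order.lt_add_one_iff.2 le_rfl).not_ge ((le_cbHeight_iff hx).2 h)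
      rw [cb_succ, mem_derivedSet, accPt_iff_frequently_nhdsNE, not_frequently] at h1
      filter_upwards [h1] with y hy hyK
      by_contra! hle
      exact hy ((le_cbHeight_iff hyK).1 hle)
  refine ⟨isClosed_kernel W, hlt, ?_⟩
  have hoff : ∀ x, x ∉ kernel W → ∀ ζ < OmegaStone.cbHeight W x,
      ∃ᶠ y in 𝓝[≠] x, y ∉ kernel W ∧ OmegaStone.cbHeight W y = ζ := by
    intro x
    induction hξ : OmegaStone.cbHeight W x using WellFoundedLT.induction generalizing x with
    | ind ξ ih =>
      intro hx ζ hζ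
      have h1 : x ∈ cb W (ζ + 1) := (le_cbHeight_iff hx).1 (hξ ▸ Order.add_one_le_of_lt hζ)
      rw [cb_succ, mem_derivedSet, accPt_iff_frequently_nhdsNE] at h1
      have h2 : ∀ᶠ y in 𝓝[≠] x, y ∉ kernel W :=
        nhdsWithin_le_nhds ((isClosed_kernel W).isOpen_compl.mem_nhds hx)
      rw [frequently_iff]
      intro U hU
      obtain ⟨V, hVU, hVo, hV⟩ : ∃ V ⊆ U, IsOpen V ∧ V ∈ 𝓝[≠] x := by
        obtain ⟨O, hO, hxO, hOU⟩ := mem_nhdsWithin.1 hU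
        exact ⟨O ∩ {x}ᶜ, hOU, hO.inter isOpen_compl_singleton,
          inter_mem (nhdsWithin_le_nhds (hO.mem_nhds hxO)) self_mem_nhdsWithin⟩
      -- `y` has height at least `ζ` and below that of `x`. If it overshoots `ζ`, the induction
      -- hypothesis at `y` gives height `ζ` inside the open set `V`.
      obtain ⟨y, hy, hyK, hylt, hyV⟩ := (h1.and_eventually (h2.and ((hlt x).and hV))).exists
      rcases ((le_cbHeight_iff hyK).2 hy).eq_or_lt with he | hlt'
      · exact ⟨y, hVU hyV, hyK, he.symm⟩
      · obtain ⟨z, hz, hzV⟩ := ((ih _ (hξ ▸ hylt hyK) y rfl hyK ζ hlt').and_eventually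
          (nhdsWithin_le_nhds (hVo.mem_nhds hyV))).exists
        exact ⟨z, hVU hzV, hz⟩
  intro x ζ hζ
  by_cases hx : x ∈ kernel W
  · rw [cbHeight_coe ⟨x, hx⟩, lt_rank_iff, mem_closure_iff_frequently, frequently_iff] at hζ
    rw [frequently_iff]
    intro U hU
    obtain ⟨O, hO, hxO, hOU⟩ := mem_nhdsWithin.1 hU
    obtain ⟨y, hyO, hy⟩ := hζ (hO.mem_nhds hxO)
    rw [mem_cb_diff_kernel] at hy
    have hyx : y ≠ x := by rintro rfl; exact hy.1 hx
    rcases hy.2.eq_or_lt with he | hlt'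
    · exact ⟨y, hOU ⟨hyO, hyx⟩, hy.1, he.symm⟩
    · obtain ⟨z, hz, hzO⟩ := ((hoff y hy.1 ζ hlt').and_eventually (nhdsWithin_le_nhds
        ((hO.inter isOpen_compl_singleton).mem_nhds ⟨hyO, hyx⟩))).exists
      exact ⟨z, hOU hzO, hz⟩
  · exact hoff x hx ζ hζ

end CantorBendixson

theorem nonempty_homeomorph_of_range_eq_compl {W : Type*} {X : Type*} {Z : Type*} {Z' : Type*}
    [TopologicalSpace W] [TopologicalSpace X] [TopologicalSpace Z] [TopologicalSpace Z']
    {j : W → Z} {j' : X → Z'} (hj : IsEmbedding j) (hj' : IsEmbedding j') {z : Z} {z' : Z'}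
    (hr : range j = {z}ᶜ) (hr' : range j' = {z'}ᶜ) (f : Z ≃ₜ Z') (hf : f z = z') :
    Nonempty (W ≃ₜ X) := by
  have h1 : range (f ∘ j) = range j' := by
    rw [range_comp, hr, hr', image_compl_eq f.bijective, image_singleton, hf]
  exact ⟨((f.isEmbedding.comp hj).toHomeomorph.trans (Homeomorph.setCongr h1)).trans
    hj'.toHomeomorph.symm⟩

/-! ### The height function on the compactification. -/

section OnePointHeight

variable {W : Type u} [TopologicalSpace W] [T2Space W] {K : Set W}

/-- The kernel of the one-point compactification: `K` together with the point at infinity. -/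
def onePointKernel (K : Set W) : Set (OnePoint W) := range (OnePoint.map ((↑) : K → W))

omit [TopologicalSpace W] [T2Space W] in
theorem coe_mem_onePointKernel {x : W} : (x : OnePoint W) ∈ onePointKernel K ↔ x ∈ K := by
  constructor
  · rintro ⟨y, hy⟩
    induction y using OnePoint.rec with
    | infty => simp at hy
    | coe y =>
      rw [OnePoint.map_some, OnePoint.coe_eq_coe] at hy
      exact hy ▸ y.2
  · exact fun hx => ⟨((⟨x, hx⟩ : K) : OnePoint K), rfl⟩

omit [TopologicalSpace W] [T2Space W] in
theorem infty_mem_onePointKernel : OnePoint.infty ∈ onePointKernel K := ⟨OnePoint.infty, rfl⟩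

theorem isClosedEmbedding_onePoint_map [LocallyCompactSpace W] (hK : IsClosed K) :
    IsClosedEmbedding (OnePoint.map ((↑) : K → W)) := by
  refine Continuous.isClosedEmbedding (OnePoint.continuous_map continuous_subtype_val ?_) ?_
  · rw [coclosedCompact_eq_cocompact, coclosedCompact_eq_cocompact]
    exact hK.isClosedEmbedding_subtypeVal.tendsto_cocompact
  · exact Option.map_injective Subtype.val_injective

/-- The closure of a layer is compact exactly when the layer stays away from `∞`; hence the least
such level is the height that `∞` must get. -/
theorem IsHeight.onePoint {h : W → Ordinal.{0}} (H : IsHeight K h) {ρ : Ordinal.{0}}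
    (h1 : IsCompact (closure (layer K h univ ρ)))
    (h2 : ∀ ζ < ρ, ¬ IsCompact (closure (layer K h univ ζ))) :
    IsHeight (onePointKernel K) (fun x : OnePoint W => x.elim ρ h) := by
  refine ⟨?_, fun x => ?_, fun x ζ hζ => ?_⟩
  · rw [OnePoint.isClosed_iff_of_mem infty_mem_onePointKernel]
    convert H.isClosed using 1
    ext x
    exact coe_mem_onePointKernel
  · induction x using OnePoint.rec with
    | infty =>
      rw [OnePoint.nhdsNE_infty_eq, eventually_map, coclosedCompact_eq_cocompact]
      filter_upwards [h1.compl_mem_cocompact] with y hy hyK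
      rw [coe_mem_onePointKernel] at hyK
      change h y < ρ
      by_contra! hle
      rcases hle.eq_or_lt with he | hlt
      · exact hy (subset_closure ⟨mem_univ _, hyK, he.symm⟩)
      -- A point higher than `ρ` is a limit of the layer at `ρ`, so it too lies in the compact
      -- closure.
      · refine hy (mem_closure_iff_nhds.2 fun U hU => ?_)
        obtain ⟨z, hz, -, hzK⟩ := H.exists_mem hlt hU
        exact ⟨z, hz, mem_univ _, hzK⟩
    | coe x =>
      rw [OnePoint.nhdsWithin_coe, eventually_map]
      have : ((↑) : W → OnePoint W) ⁻¹' {(x : OnePoint W)}ᶜ = {x}ᶜ := by ext y; simp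
      rw [this]
      filter_upwards [H.lt x] with y hy hyK
      exact hy (mt coe_mem_onePointKernel.2 hyK)
  · induction x using OnePoint.rec with
    | infty =>
      rw [OnePoint.nhdsNE_infty_eq, frequently_map, coclosedCompact_eq_cocompact]
      intro hev
      refine h2 ζ hζ ?_
      obtain ⟨C, hC, hCs⟩ := mem_cocompact.1 hev
      refine hC.of_isClosed_subset isClosed_closure (closure_minimal (fun y hy => ?_) hC.isClosed)
      by_contra hyC
      exact hCs hyC ⟨mt coe_mem_onePointKernel.1 hy.2.1, hy.2.2⟩
    | coe x =>
      rw [OnePoint.nhdsWithin_coe, frequently_map]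
      have : ((↑) : W → OnePoint W) ⁻¹' {(x : OnePoint W)}ᶜ = {x}ᶜ := by ext y; simp
      rw [this]
      exact (H.freq x ζ hζ).mono fun y hy => ⟨mt coe_mem_onePointKernel.1 hy.1, hy.2⟩

omit [TopologicalSpace W] [T2Space W] in
theorem layer_onePoint (h : W → Ordinal.{0}) (ρ ξ : Ordinal.{0}) :
    layer (onePointKernel K) (fun x : OnePoint W => x.elim ρ h) univ ξ =
      (↑) '' layer K h univ ξ := by
  ext x
  induction x using OnePoint.rec with
  | infty => simp [layer, infty_mem_onePointKernel]
  | coe x => simp [layer, coe_mem_onePointKernel]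

end OnePointHeight

/-! ### Strongly uniform spaces are determined by kernel and rank. -/

section Uniqueness

variable {W : Type u} [TopologicalSpace W] [T2Space W] [SecondCountableTopology W]

theorem layer_cbHeight (ξ : Ordinal.{0}) :
    layer (kernel W) (cbHeight W) univ ξ = cbLayer W ξ := by
  ext x
  rw [mem_cbLayer]
  simp [layer]

theorem lt_nu_of_lt_rank {x : kernel W} {ζ : Ordinal.{0}} (h : ζ < (rank W x : Ordinal.{0})) :
    ζ < nu W := by
  obtain ⟨y, hy⟩ := closure_nonempty_iff.1 ⟨_, lt_rank_iff.1 h⟩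
  rw [mem_cb_diff_kernel] at hy
  exact hy.2.trans_lt (cbHeight_lt_nu hy.1)

/-- Below `λ` the set `W^(ζ) \ K` is not closed; a limit point outside it still lies in the closed
set `W^(ζ)`, hence in `K`, with rank above `ζ`. -/
theorem IsUniform.lt_nu_iff (hW : IsUniform W) {ζ : Ordinal.{0}} :
    ζ < nu W ↔ ∃ x : kernel W, ζ < (rank W x : Ordinal.{0}) := by
  refine ⟨fun h => ?_, fun ⟨x, hx⟩ => lt_nu_of_lt_rank hx⟩
  rw [hW] at h
  have h1 : ¬ IsClosed (cb W ζ \ kernel W) := fun hc => notMem_of_lt_csInf' h hc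
  rw [← closure_subset_iff_isClosed, not_subset] at h1
  obtain ⟨x, hx, hxK⟩ := h1
  have hxcb : x ∈ cb W ζ := closure_minimal sdiff_subset (isClosed_cb ζ) hx
  have hxk : x ∈ kernel W := by
    by_contra hk
    exact hxK ⟨hxcb, hk⟩
  exact ⟨⟨x, hxk⟩, lt_rank_iff.2 hx⟩

open Classical in
theorem IsUniform.encard_cbLayer (hW : IsUniform W) (ξ : Ordinal.{0}) :
    (cbLayer W ξ).encard = if ∃ x : kernel W, ξ < (rank W x : Ordinal.{0}) then ⊤ else 0 := by
  rw [← hW.lt_nu_iff, ← layer_cbHeight]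
  split_ifs with h
  · obtain ⟨x, hx⟩ := hW.lt_nu_iff.1 h
    exact (IsHeight.cbHeight.infinite_layer isOpen_univ (mem_univ (x : W))
      (by rwa [cbHeight_coe])).encard_eq
  · rw [encard_eq_zero]
    refine eq_empty_of_forall_notMem fun x hx => h ?_
    rw [← hx.2.2]
    exact cbHeight_lt_nu hx.2.1

omit [T2Space W] [SecondCountableTopology W] in
theorem isCompact_kernelAbove_iff {ξ : Ordinal.{0}} :
    IsCompact (kernelAbove W ξ) ↔ IsCompact {x : kernel W | ξ < (rank W x : Ordinal.{0})} := by
  have : kernelAbove W ξ = (↑) '' {x : kernel W | ξ < (rank W x : Ordinal.{0})} := by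
    ext x
    constructor
    · rintro ⟨h1, h2⟩
      exact ⟨⟨x, h1⟩, h2, rfl⟩
    · rintro ⟨y, h1, rfl⟩
      exact ⟨y.2, h1⟩
  rw [this, ← Subtype.isCompact_iff]

theorem isHeight_onePoint_cbHeight : IsHeight (onePointKernel (kernel W))
    (fun x : OnePoint W => x.elim (rho W) (cbHeight W)) := by
  refine IsHeight.cbHeight.onePoint ?_ fun ζ hζ => ?_
  · rw [layer_cbHeight]
    refine csInf_mem (s := {ξ | IsCompact (closure (cbLayer W ξ))}) ⟨nu W, ?_⟩
    have : cbLayer W (nu W) = ∅ := by rw [cbLayer, ← cb_nu, sdiff_self]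
    rw [mem_ofPred_eq, this, closure_empty]
    exact isCompact_empty
  · rw [layer_cbHeight]
    exact fun hc => notMem_of_lt_csInf' (s := {ξ | IsCompact (closure (cbLayer W ξ))}) hζ hc

variable {X : Type v} [TopologicalSpace X]

omit [T2Space W] [SecondCountableTopology W] in
theorem RankIso.rhoU_eq (h : RankIso (rank W) (rank X)) : rhoU W = rhoU X := by
  obtain ⟨φ, hφ⟩ := h
  unfold rhoU
  congr 1
  ext ξ
  rw [mem_ofPred_eq, mem_ofPred_eq, isCompact_kernelAbove_iff, isCompact_kernelAbove_iff,
    ← φ.isCompact_preimage]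
  simp only [preimage_ofPred_eq, hφ]

variable [LocallyCompactSpace W] [TotallyDisconnectedSpace W]
  [T2Space X] [SecondCountableTopology X] [LocallyCompactSpace X] [TotallyDisconnectedSpace X]

theorem RankIso.nonempty_homeomorph (hW : IsStronglyUniform W) (hX : IsStronglyUniform X)
    (h : RankIso (rank W) (rank X)) : Nonempty (W ≃ₜ X) := by
  have hρ : rho W = rho X := by rw [← hW.2, ← hX.2, h.rhoU_eq]
  obtain ⟨φ, hφ⟩ := h
  let eW := (isClosedEmbedding_onePoint_map (isClosed_kernel W)).isEmbedding.toHomeomorph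
  let eX := (isClosedEmbedding_onePoint_map (isClosed_kernel X)).isEmbedding.toHomeomorph
  let ψ : onePointKernel (kernel W) ≃ₜ onePointKernel (kernel X) :=
    (eW.symm.trans φ.onePointCongr).trans eX
  have hψ : ∀ y, ψ (eW y) = eX (φ.onePointCongr y) := fun y =>
    congrArg (fun z => eX (φ.onePointCongr z)) (eW.symm_apply_apply y)
  obtain ⟨f, hf⟩ := exists_homeomorph_extending isHeight_onePoint_cbHeight
    isHeight_onePoint_cbHeight ψ (by
      intro x
      obtain ⟨y, rfl⟩ := eW.surjective x
      rw [hψ]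
      induction y using OnePoint.rec with
      -- Strong uniformity is used here: the two points at infinity have the same height.
      | infty => exact hρ.symm
      | coe y =>
        change cbHeight X (φ y : X) = cbHeight W (y : W)
        rw [cbHeight_coe, cbHeight_coe, hφ]) (by
      intro ξ
      rw [layer_onePoint, layer_onePoint, OnePoint.coe_injective.encard_image,
        OnePoint.coe_injective.encard_image, layer_cbHeight, layer_cbHeight,
        hW.1.encard_cbLayer, hX.1.encard_cbLayer]
      congr 1
      rw [eq_iff_iff, φ.surjective.exists]
      simp only [hφ])
  refine nonempty_homeomorph_of_range_eq_compl OnePoint.isOpenEmbedding_coe.isEmbedding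
    OnePoint.isOpenEmbedding_coe.isEmbedding OnePoint.compl_infty.symm OnePoint.compl_infty.symm
    f (z := OnePoint.infty) ?_
  -- `∞` belongs to the enlarged kernel, so `f` agrees there with `ψ`, which fixes it.
  have := hf (eW OnePoint.infty)
  rw [hψ] at this
  exact this

end Uniqueness

/-! ### Homeomorphisms preserve kernel and rank. -/

section Invariance

variable {W : Type u} {X : Type v} [TopologicalSpace W] [TopologicalSpace X]

theorem image_derivedSet (f : W ≃ₜ X) (S : Set W) : f '' derivedSet S = derivedSet (f '' S) := by
  refine (f.continuous.image_derivedSet f.injective).antisymm fun x hx => ?_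
  have := f.symm.continuous.image_derivedSet f.symm.injective ⟨x, hx, rfl⟩
  rw [← image_comp, f.symm_comp_self, image_id] at this
  exact ⟨_, this, f.apply_symm_apply x⟩

theorem image_cb (f : W ≃ₜ X) (ξ : Ordinal.{0}) : f '' cb W ξ = cb X ξ := by
  induction ξ using Ordinal.limitRecOn with
  | zero => rw [cb_zero, cb_zero, image_univ, f.range_coe]
  | add_one ξ ih => rw [cb_succ, cb_succ, image_derivedSet, ih]
  | limit η hη ih =>
    rw [cb_limit _ _ hη, cb_limit _ _ hη]
    simp only [image_iInter f.bijective]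
    exact iInter₂_congr ih

theorem nu_congr (f : W ≃ₜ X) : nu W = nu X := by
  unfold nu
  congr 1
  ext ξ
  rw [mem_ofPred_eq, mem_ofPred_eq, ← image_cb f, ← image_cb f, f.injective.image_injective.eq_iff]

theorem image_kernel (f : W ≃ₜ X) : f '' kernel W = kernel X := by
  rw [kernel, image_cb, nu_congr f, kernel]

theorem rankIso_of_homeomorph (f : W ≃ₜ X) : RankIso (rank W) (rank X) := by
  refine ⟨(f.image _).trans (Homeomorph.setCongr (image_kernel f)), fun x => ?_⟩
  refine Subtype.ext ?_
  unfold rank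
  dsimp only
  congr 1
  ext ξ
  have : f '' closure (cb W ξ \ kernel W) = closure (cb X ξ \ kernel X) := by
    rw [f.image_closure, image_sdiff f.injective, image_cb, image_kernel]
  rw [mem_ofPred_eq, mem_ofPred_eq, ← this]
  exact and_congr Iff.rfl (not_congr f.injective.mem_set_image)

end Invariance

/-! ### Perfect spaces and the Cantor set. -/

theorem perfectSpace_iff_not_isOpen_singleton {Z : Type*} [TopologicalSpace Z] :
    PerfectSpace Z ↔ ∀ x : Z, ¬ IsOpen ({x} : Set Z) := by
  rw [perfectSpace_iff_forall_not_isolated]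
  refine forall_congr' fun x => ?_
  rw [isOpen_singleton_iff_punctured_nhds, neBot_iff]

theorem perfectSpace_of_isOpenMap {A B : Type*} [TopologicalSpace A] [TopologicalSpace B]
    [PerfectSpace B] {j : A → B} (hj : IsOpenMap j) : PerfectSpace A := by
  rw [perfectSpace_iff_not_isOpen_singleton]
  intro x hx
  have := hj _ hx
  rw [image_singleton] at this
  exact perfectSpace_iff_not_isOpen_singleton.1 ‹_› _ this

instance perfectSpace_nat_bool : PerfectSpace (ℕ → Bool) := by
  rw [perfectSpace_iff_forall_not_isolated]
  intro x
  have h : Tendsto (fun n => Function.update x n (!x n)) atTop (𝓝[≠] x) := by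
    refine tendsto_nhdsWithin_iff.2 ⟨tendsto_pi_nhds.2 fun i => ?_, Eventually.of_forall fun n hn => ?_⟩
    · refine tendsto_const_nhds.congr' ?_
      filter_upwards [eventually_gt_atTop i] with n hn
      rw [Function.update_of_ne hn.ne]
    · have := congrFun hn n
      simp at this
  exact h.neBot

instance perfectSpace_cantorSet : PerfectSpace D₁ :=
  perfectSpace_of_isOpenMap cantorSetHomeomorphNatToBool.isOpenMap

/-- The inclusion of the punctured Cantor set in the Cantor set. -/
def puncturedInclusion : D₀ → D₁ := fun x => ⟨x, x.2.1⟩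

theorem isEmbedding_puncturedInclusion : IsEmbedding puncturedInclusion :=
  IsEmbedding.inclusion sdiff_subset

theorem range_puncturedInclusion :
    range puncturedInclusion = {(⟨0, zero_mem_cantorSet⟩ : D₁)}ᶜ := by
  ext x
  constructor
  · rintro ⟨y, rfl⟩ h
    exact y.2.2 (congrArg Subtype.val h)
  · exact fun h => ⟨⟨x, x.2, fun h0 => h (Subtype.ext h0)⟩, rfl⟩

theorem isOpenEmbedding_puncturedInclusion : IsOpenEmbedding puncturedInclusion :=
  ⟨isEmbedding_puncturedInclusion, by
    rw [range_puncturedInclusion]; exact isOpen_compl_singleton⟩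

instance perfectSpace_puncturedCantorSet : PerfectSpace D₀ :=
  perfectSpace_of_isOpenMap isOpenEmbedding_puncturedInclusion.isOpenMap

section Brouwer

variable {Z : Type u} {Z' : Type v} [TopologicalSpace Z] [TopologicalSpace Z']

/-- `A` and `A'` are both empty or both non-empty, and contain `z`, respectively `z'`, together. -/
def PointMatched (z : Z) (z' : Z') (A : Clopens Z) (A' : Clopens Z') : Prop :=
  (A = ⊥ ↔ A' = ⊥) ∧ (z ∈ A ↔ z' ∈ A')

theorem PointMatched.symm {z : Z} {z' : Z'} {A : Clopens Z} {A' : Clopens Z'}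
    (h : PointMatched z z' A A') : PointMatched z' z A' A := ⟨h.1.symm, h.2.symm⟩

theorem clopens_ne_bot_of_mem {A : Clopens Z} {x : Z} (hx : x ∈ A) : A ≠ ⊥ := by
  rintro rfl
  exact hx

theorem exists_mem_of_ne_bot {A : Clopens Z} (hA : A ≠ ⊥) : ∃ x, x ∈ A :=
  nonempty_iff_ne_empty.2 fun he => hA (Clopens.ext he)

variable [T2Space Z'] [CompactSpace Z'] [TotallyDisconnectedSpace Z'] [PerfectSpace Z']

theorem PointMatched.split {z : Z} {z' : Z'} {A : Clopens Z} {A' : Clopens Z'}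
    (h : PointMatched z z' A A') (C : Clopens Z) :
    ∃ C', PointMatched z z' (A ⊓ C) (A' ⊓ C') ∧ PointMatched z z' (A \ C) (A' \ C') := by
  have hbot : PointMatched z z' ⊥ ⊥ := ⟨by simp, Iff.rfl⟩
  rcases eq_or_ne (A ⊓ C) ⊥ with h0 | h0
  · refine ⟨⊥, ?_, ?_⟩
    · rwa [h0, inf_bot_eq]
    · rwa [sdiff_bot, (disjoint_iff.2 h0).sdiff_eq_left]
  rcases eq_or_ne (A \ C) ⊥ with h1 | h1
  · refine ⟨⊤, ?_, ?_⟩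
    · rwa [inf_top_eq, inf_eq_left.2 (sdiff_eq_bot_iff.1 h1)]
    · rwa [h1, sdiff_top]
  -- `w` stands for `z'` whenever the base point is in play; perfectness gives a second point `y`,
  -- and the side of the split with `w` is matched to the side determined by `z`.
  obtain ⟨w, hw, hwz⟩ : ∃ w, w ∈ A' ∧ (z ∈ A → w = z') := by
    by_cases hz : z ∈ A
    · exact ⟨z', h.2.1 hz, fun _ => rfl⟩
    · obtain ⟨q, hq⟩ := exists_mem_of_ne_bot h0
      obtain ⟨w, hw⟩ := exists_mem_of_ne_bot (mt h.1.2 (clopens_ne_bot_of_mem hq.1))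
      exact ⟨w, hw, fun hz' => absurd hz' hz⟩
  obtain ⟨y, hy, hyw⟩ : ∃ y ∈ A', y ≠ w := by
    have h2 : ∀ᶠ y in 𝓝[≠] w, y ∈ A' := nhdsWithin_le_nhds (A'.isOpen.mem_nhds hw)
    obtain ⟨y, hy⟩ := (h2.and self_mem_nhdsWithin).exists
    exact ⟨y, hy⟩
  obtain ⟨V, hV, hwV, hyV⟩ := exists_isClopen_of_totally_separated hyw.symm
  have hz' : z' ∈ A' → z ∈ A ∧ w = z' := fun hz' => ⟨h.2.2 hz', hwz (h.2.2 hz')⟩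
  by_cases hzC : z ∈ C
  · refine ⟨⟨V, hV⟩, ⟨iff_of_false h0 (clopens_ne_bot_of_mem ⟨hw, hwV⟩), fun hz => ?_, fun hz => ?_⟩,
      ⟨iff_of_false h1 (clopens_ne_bot_of_mem ⟨hy, hyV⟩), fun hz => absurd hzC hz.2, fun hz => ?_⟩⟩
    · exact ⟨h.2.1 hz.1, hwz hz.1 ▸ hwV⟩
    · exact ⟨h.2.2 hz.1, hzC⟩
    · exact absurd ((hz' hz.1).2 ▸ hwV) hz.2
  · refine ⟨⟨Vᶜ, hV.compl⟩, ⟨iff_of_false h0 (clopens_ne_bot_of_mem ⟨hy, hyV⟩),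
      fun hz => absurd hz.2 hzC, fun hz => ?_⟩,
      ⟨iff_of_false h1 (clopens_ne_bot_of_mem ⟨hw, fun hwn => hwn hwV⟩), fun hz => ?_, fun hz => ?_⟩⟩
    · exact absurd ((hz' hz.1).2 ▸ hwV) hz.2
    · exact ⟨h.2.1 hz.1, fun hn => hn (hwz hz.1 ▸ hwV)⟩
    · exact ⟨h.2.2 hz.1, hzC⟩

/-- Brouwer's characterisation of the Cantor set, with a base point. -/
theorem exists_homeomorph_of_perfectSpace [SecondCountableTopology Z'] [T2Space Z] [CompactSpace Z]
    [TotallyDisconnectedSpace Z] [SecondCountableTopology Z] [PerfectSpace Z] (z : Z) (z' : Z') :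
    ∃ f : Z ≃ₜ Z', f z = z' := by
  obtain ⟨f, hf⟩ := exists_homeomorph_of_splitting (PointMatched z z')
    ⟨iff_of_false (clopens_ne_bot_of_mem (mem_univ z)) (clopens_ne_bot_of_mem (mem_univ z')),
      iff_of_true (mem_univ _) (mem_univ _)⟩
    (fun _ _ h => h.1) (fun _ _ h C => h.split C) (fun _ _ h C' => by
      obtain ⟨C, h1, h2⟩ := h.symm.split C'
      exact ⟨C, h1.symm, h2.symm⟩)
  refine ⟨f, ?_⟩
  by_contra hne
  obtain ⟨V, hV, hx, hx'⟩ := exists_isClopen_of_totally_separated hne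
  obtain ⟨A, A', hA, hxA, -, hAV⟩ := hf z ⟨V, hV⟩ hx
  exact hx' (hAV (hA.2.1 hxA))

end Brouwer

instance totallyDisconnectedSpace_cantorSet : TotallyDisconnectedSpace D₁ :=
  cantorSetHomeomorphNatToBool.isEmbedding.isTotallyDisconnected_range.1
    (isTotallyDisconnected_of_totallyDisconnectedSpace _)

instance compactSpace_cantorSet : CompactSpace D₁ :=
  isCompact_iff_compactSpace.1 isCompact_cantorSet

theorem homeomorph_cantorSet_of_perfectSpace {K : Type u} [TopologicalSpace K] [T2Space K]
    [LocallyCompactSpace K] [TotallyDisconnectedSpace K] [SecondCountableTopology K]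
    [PerfectSpace K] [Nonempty K] : Nonempty (K ≃ₜ D₀) ∨ Nonempty (K ≃ₜ D₁) := by
  let z : D₁ := ⟨0, zero_mem_cantorSet⟩
  by_cases hc : CompactSpace K
  · obtain ⟨f, -⟩ := exists_homeomorph_of_perfectSpace (Classical.arbitrary K) z
    exact Or.inr ⟨f⟩
  · rw [not_compactSpace_iff] at hc
    have : PerfectSpace (OnePoint K) := perfectSpace_iff_forall_not_isolated.2 inferInstance
    -- The base points make `∞` correspond to `0`, the point removed from the Cantor set to form
    -- `D₀`.
    obtain ⟨f, hf⟩ := exists_homeomorph_of_perfectSpace (OnePoint.infty : OnePoint K) z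
    exact Or.inl (nonempty_homeomorph_of_range_eq_compl OnePoint.isOpenEmbedding_coe.isEmbedding
      isEmbedding_puncturedInclusion OnePoint.compl_infty.symm range_puncturedInclusion f hf)

/-! ### Admissibility of the invariant. -/

section Admissible

variable {W : Type u} [TopologicalSpace W] [T2Space W] [SecondCountableTopology W]

omit [T2Space W] [SecondCountableTopology W] in
theorem perfectSpace_of_subset_derivedSet {K : Set W} (hK : K ⊆ derivedSet K) : PerfectSpace K := by
  rw [perfectSpace_iff_not_isOpen_singleton]
  intro x hx
  obtain ⟨U, hU, hUx⟩ := isOpen_induced_iff.1 hx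
  have hxU : (x : W) ∈ U := by
    have : x ∈ ((↑) : K → W) ⁻¹' U := hUx ▸ rfl
    exact this
  obtain ⟨y, ⟨hyU, hyK⟩, hne⟩ := accPt_iff_nhds.1 (hK x.2) U (hU.mem_nhds hxU)
  have : (⟨y, hyK⟩ : K) ∈ ((↑) : K → W) ⁻¹' U := hyU
  rw [hUx] at this
  exact hne (congrArg Subtype.val this)

instance perfectSpace_kernel : PerfectSpace (kernel W) :=
  perfectSpace_of_subset_derivedSet (derivedSet_kernel W).ge

theorem upperSemicontinuous_rank : UpperSemicontinuous (rank W) := by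
  intro x ξ hξ
  have h := continuous_subtype_val.continuousAt.eventually
    (IsHeight.cbHeight.eventually_le (x : W))
  filter_upwards [h] with y hy
  rw [cbHeight_coe, cbHeight_coe] at hy
  exact lt_of_le_of_lt (show rank W y ≤ rank W x from hy) hξ

/-- Under uniformity an empty kernel forces `ν(W) = 0`, and then the kernel is all of `W`. -/
theorem IsUniform.kernel_nonempty [Nonempty W] (hW : IsUniform W) : Nonempty (kernel W) := by
  by_contra hK
  rw [not_nonempty_iff] at hK
  have h0 : ¬ 0 < nu W := fun h => by
    obtain ⟨x, -⟩ := hW.lt_nu_iff.1 h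
    exact hK.false x
  have h1 : kernel W = univ := by rw [kernel, nonpos_iff_eq_zero.1 (not_lt.1 h0), cb_zero]
  exact hK.false ⟨Classical.arbitrary W, h1 ▸ mem_univ _⟩

theorem IsUniform.isAdmissible_rank [LocallyCompactSpace W] [TotallyDisconnectedSpace W]
    [Nonempty W] (hW : IsUniform W) : IsAdmissible (rank W) := by
  have := hW.kernel_nonempty
  have : LocallyCompactSpace (kernel W) := (isClosed_kernel W).locallyCompactSpace
  exact ⟨homeomorph_cantorSet_of_perfectSpace, upperSemicontinuous_rank⟩

end Admissible

/-! ### Attaching scattered spaces to a base. -/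

/-- A compact scattered space whose heights are at most `ξ`, with `ξ` attained. -/
structure ScatteredModel (ξ : Ordinal.{0}) : Type 1 where
  carrier : Type
  [top : TopologicalSpace carrier]
  [t2 : T2Space carrier]
  [compact : CompactSpace carrier]
  [totallyDisconnected : TotallyDisconnectedSpace carrier]
  [secondCountable : SecondCountableTopology carrier]
  height : carrier → Ordinal.{0}
  isHeight : IsHeight ∅ height
  le : ∀ s, height s ≤ ξ
  apex : carrier
  height_apex : height apex = ξ

attribute [instance] ScatteredModel.top ScatteredModel.t2 ScatteredModel.compact
  ScatteredModel.totallyDisconnected ScatteredModel.secondCountable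

theorem ScatteredModel.exists_height_eq {ξ : Ordinal.{0}} (S : ScatteredModel ξ) {ζ : Ordinal.{0}}
    (hζ : ζ ≤ ξ) : ∃ s, S.height s = ζ := by
  rcases hζ.eq_or_lt with rfl | hlt
  · exact ⟨S.apex, S.height_apex⟩
  · obtain ⟨s, hs⟩ := (S.isHeight.freq S.apex ζ (by rwa [S.height_apex])).exists
    exact ⟨s, hs.2⟩

instance locallyCompactSpace_sigma {ι : Type*} {S : ι → Type*} [∀ i, TopologicalSpace (S i)]
    [∀ i, CompactSpace (S i)] [∀ i, T2Space (S i)] : LocallyCompactSpace (Σ i, S i) := by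
  have : WeaklyLocallyCompactSpace (Σ i, S i) := ⟨fun ⟨i, s⟩ =>
    ⟨range (Sigma.mk i), isCompact_range continuous_sigmaMk,
      isOpenMap_sigmaMk.isOpen_range.mem_nhds ⟨s, rfl⟩⟩⟩
  infer_instance

section Glue

variable {K : Type u} {ι : Type} {ξ : ι → Ordinal.{0}}

/-- The space obtained from `K` by attaching, for each `i`, a copy of `S i` lying over the point
`x i`, in such a way that the copies shrink to `K`. -/
def glueSet (S : ∀ i, ScatteredModel (ξ i)) (x : ι → K) :
    Set (K × OnePoint (Σ i, (S i).carrier)) :=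
  {p | ∀ i s, p.2 = ((⟨i, s⟩ : Σ i, (S i).carrier) : OnePoint _) → p.1 = x i}

variable (S : ∀ i, ScatteredModel (ξ i)) (x : ι → K)

/-- The inclusion of the base. -/
def glueBase (k : K) : glueSet S x := ⟨(k, OnePoint.infty), fun _ _ h => by simp at h⟩

/-- The inclusion of the attached space of index `i`. -/
def glueAttach (i : ι) (s : (S i).carrier) : glueSet S x :=
  ⟨(x i, ((⟨i, s⟩ : Σ i, (S i).carrier) : OnePoint _)), fun j t h => by
    rw [OnePoint.coe_eq_coe] at h
    obtain rfl : i = j := congrArg Sigma.fst h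
    rfl⟩

/-- The projection to the base. -/
def glueProj (p : glueSet S x) : K := p.1.1

/-- The height function on the glued space. -/
def glueHeight (r : K → Ordinal.{0}) (p : glueSet S x) : Ordinal.{0} :=
  p.1.2.elim (r p.1.1) fun q => (S q.1).height q.2

variable {S x}

theorem glue_cases (p : glueSet S x) :
    (∃ k, p = glueBase S x k) ∨ ∃ i s, p = glueAttach S x i s := by
  obtain ⟨⟨k, q⟩, hp⟩ := p
  induction q using OnePoint.rec with
  | infty => exact Or.inl ⟨k, rfl⟩
  | coe q =>
    obtain ⟨i, s⟩ := q
    obtain rfl : k = x i := hp i s rfl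
    exact Or.inr ⟨i, s, rfl⟩

theorem mem_range_glueBase {p : glueSet S x} : p ∈ range (glueBase S x) ↔ p.1.2 = OnePoint.infty := by
  constructor
  · rintro ⟨k, rfl⟩
    rfl
  · obtain ⟨k, rfl⟩ | ⟨i, s, rfl⟩ := glue_cases p
    · exact fun _ => ⟨k, rfl⟩
    · exact fun h => absurd h (OnePoint.coe_ne_infty _)

theorem glueAttach_notMem_range {i : ι} {s : (S i).carrier} :
    glueAttach S x i s ∉ range (glueBase S x) := fun h =>
  OnePoint.coe_ne_infty _ (mem_range_glueBase.1 h)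

theorem glueHeight_base (r : K → Ordinal.{0}) (k : K) : glueHeight S x r (glueBase S x k) = r k := rfl

variable [TopologicalSpace K]

theorem isOpen_range_coe_sigmaMk (i : ι) :
    IsOpen (range fun s : (S i).carrier => (OnePoint.some ⟨i, s⟩ : OnePoint (Σ i, (S i).carrier))) :=
  (OnePoint.isOpenEmbedding_coe.comp (IsOpenEmbedding.sigmaMk (i := i))).isOpen_range

theorem isClosed_glueSet [T1Space K] : IsClosed (glueSet S x) := by
  have : glueSet S x = ⋂ i, ((Prod.snd ⁻¹'
      (range fun s : (S i).carrier => (OnePoint.some ⟨i, s⟩ : OnePoint (Σ i, (S i).carrier)))ᶜ) ∪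
      Prod.fst ⁻¹' {x i}) := by
    ext p
    simp only [glueSet, mem_ofPred_eq, mem_iInter, Set.mem_union, mem_preimage, mem_compl_iff,
      mem_range, mem_singleton_iff, ← imp_iff_not_or, forall_exists_index]
    exact forall_congr' fun i => forall_congr' fun s => imp_congr eq_comm Iff.rfl
  rw [this]
  exact isClosed_iInter fun i =>
    ((isOpen_range_coe_sigmaMk i).isClosed_compl.preimage continuous_snd).union
      (isClosed_singleton.preimage continuous_fst)

theorem continuous_glueProj : Continuous (glueProj S x) :=
  continuous_fst.comp continuous_subtype_val

theorem isEmbedding_glueBase : IsEmbedding (glueBase S x) :=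
  IsEmbedding.of_comp (by unfold glueBase; fun_prop) continuous_glueProj IsEmbedding.id

theorem isClosed_range_glueBase : IsClosed (range (glueBase S x)) := by
  have : range (glueBase S x) = (fun p : glueSet S x => p.1.2) ⁻¹' {OnePoint.infty} := by
    ext p
    exact mem_range_glueBase
  rw [this]
  exact isClosed_singleton.preimage (continuous_snd.comp continuous_subtype_val)

theorem isOpenEmbedding_glueAttach (i : ι) : IsOpenEmbedding (glueAttach S x i) := by
  have hj := OnePoint.isOpenEmbedding_coe.comp
    (IsOpenEmbedding.sigmaMk (σ := fun i => (S i).carrier) (i := i))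
  have hc : Continuous fun p : glueSet S x => p.1.2 := continuous_snd.comp continuous_subtype_val
  refine ⟨IsEmbedding.of_comp ?_ hc hj.isEmbedding, ?_⟩
  · exact (continuous_const.prodMk hj.continuous).subtype_mk _
  · have : range (glueAttach S x i) = (fun p : glueSet S x => p.1.2) ⁻¹' (range
        fun s : (S i).carrier => (OnePoint.some ⟨i, s⟩ : OnePoint (Σ i, (S i).carrier))) := by
      ext p
      constructor
      · rintro ⟨s, rfl⟩
        exact ⟨s, rfl⟩
      · rintro ⟨s, hs⟩
        exact ⟨s, Subtype.ext (Prod.ext (p.2 i s hs.symm).symm hs)⟩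
    rw [this]
    exact (isOpen_range_coe_sigmaMk i).preimage hc

theorem isCompact_preimage_glueProj [T1Space K] {C : Set K} (hC : IsCompact C) :
    IsCompact (glueProj S x ⁻¹' C) := by
  rw [Subtype.isCompact_iff]
  have : (↑) '' (glueProj S x ⁻¹' C) = (C ×ˢ univ) ∩ glueSet S x := by
    ext p
    constructor
    · rintro ⟨q, hq, rfl⟩
      exact ⟨⟨hq, mem_univ _⟩, q.2⟩
    · rintro ⟨hp, hq⟩
      exact ⟨⟨p, hq⟩, hp.1, rfl⟩
  rw [this]
  exact (hC.prod isCompact_univ).inter_right isClosed_glueSet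

omit [TopologicalSpace K] in
theorem glueHeight_lt {r : K → Ordinal.{0}} (hξ : ∀ i, ξ i < r (x i)) {p : glueSet S x}
    (hp : p ∉ range (glueBase S x)) : glueHeight S x r p < r (glueProj S x p) := by
  obtain ⟨k, rfl⟩ | ⟨i, s, rfl⟩ := glue_cases p
  · exact absurd ⟨k, rfl⟩ hp
  · exact ((S i).le s).trans_lt (hξ i)

theorem finite_setOf_mem_sigma {C : Set (Σ i, (S i).carrier)} (hC : IsCompact C) :
    {i | ∃ s, (⟨i, s⟩ : Σ i, (S i).carrier) ∈ C}.Finite := by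
  let : TopologicalSpace ι := ⊥
  have : DiscreteTopology ι := ⟨rfl⟩
  have h1 : Continuous (Sigma.fst : (Σ i, (S i).carrier) → ι) :=
    continuous_sigma fun i => continuous_const
  refine (isCompact_iff_finite.1 (hC.image h1)).subset ?_
  rintro i ⟨s, hs⟩
  exact ⟨_, hs, rfl⟩

/-- Each attached copy is open, so its own height function settles its points. At a base point, `lt`
comes from semicontinuity of `r` with `hξ`, and `freq` from `hdense`. -/
theorem isHeight_glueHeight {r : K → Ordinal.{0}} (hr : ∀ k, ∀ᶠ y in 𝓝 k, r y ≤ r k)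
    (hξ : ∀ i, ξ i < r (x i))
    (hdense : ∀ k, ∀ ζ < r k, ∀ A ∈ 𝓝 k, {i | x i ∈ A ∧ ξ i = ζ}.Infinite) :
    IsHeight (range (glueBase S x)) (glueHeight S x r) := by
  have hnhds : ∀ i s, 𝓝[≠] (glueAttach S x i s) = map (glueAttach S x i) (𝓝[≠] s) := by
    intro i s
    have h1 := (isOpenEmbedding_glueAttach (S := S) (x := x) i)
    rw [← h1.map_nhdsWithin_preimage_eq]
    congr 2
    ext t
    simp [h1.injective.eq_iff]
  refine ⟨isClosed_range_glueBase, fun p => ?_, fun p ζ hζ => ?_⟩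
  · obtain ⟨k, rfl⟩ | ⟨i, s, rfl⟩ := glue_cases p
    · have h1 : ∀ᶠ q in 𝓝 (glueBase S x k), r (glueProj S x q) ≤ r k :=
        (continuous_glueProj.tendsto (glueBase S x k)).eventually (hr k)
      filter_upwards [nhdsWithin_le_nhds h1] with q hq hqK
      exact (glueHeight_lt hξ hqK).trans_le hq
    · rw [hnhds, eventually_map]
      filter_upwards [(S i).isHeight.lt s] with t ht _
      exact ht (notMem_empty t)
  · obtain ⟨k, rfl⟩ | ⟨i, s, rfl⟩ := glue_cases p
    · rw [frequently_nhdsWithin_iff, frequently_iff]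
      intro U hU
      obtain ⟨V, hV, hVU⟩ := mem_nhds_induced _ _ _ |>.1 hU
      obtain ⟨A, hA, B, hB, hABV⟩ := mem_nhds_prod_iff.1 hV
      obtain ⟨C, ⟨-, hC⟩, hCB⟩ := OnePoint.hasBasis_nhds_infty.mem_iff.1 hB
      -- A neighbourhood of `∞` may omit a compact set, which meets only finitely many copies;
      -- infinitely many indices leave one to spare.
      obtain ⟨i, ⟨hiA, hiζ⟩, hiC⟩ :=
        (hdense k ζ hζ A hA).exists_notMem_finite (finite_setOf_mem_sigma hC)
      obtain ⟨s, hs⟩ := (S i).exists_height_eq hiζ.ge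
      refine ⟨glueAttach S x i s, hVU (hABV ⟨hiA, hCB (Or.inl ⟨_, fun h => hiC ⟨s, h⟩, rfl⟩)⟩),
        ⟨glueAttach_notMem_range, hs⟩, fun h => ?_⟩
      exact glueAttach_notMem_range ⟨k, h.symm⟩
    · rw [hnhds, frequently_map]
      exact ((S i).isHeight.freq s ζ hζ).mono fun t ht => ⟨glueAttach_notMem_range, ht.2⟩

end Glue

/-! ### Existence of scattered models and realisations. -/

theorem countable_Iio_of_lt_omega_one {β : Ordinal.{0}} (h : β < ω₁) : (Iio β).Countable := by
  rw [← Cardinal.le_aleph0_iff_set_countable, Cardinal.mk_Iio_ordinal, Cardinal.lift_le_aleph0,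
    ← Cardinal.lt_aleph_one_iff, ← Cardinal.lt_ord, Cardinal.ord_aleph]
  exact h

/-- For each basic set and each `ζ` below some value of `r` on it, one point is chosen and repeated
`ℕ` times. Countably many pairs suffice: by semicontinuity, countably many neighbourhoods on which
`r` is bounded by one of its values cover `K`. -/
theorem exists_attaching_points {K : Type u} [TopologicalSpace K] [SecondCountableTopology K]
    {r : K → Ordinal.{0}} (hr : ∀ k, ∀ᶠ y in 𝓝 k, r y ≤ r k) (hω : ∀ k, r k < ω₁) :
    ∃ (ι : Type) (_ : Countable ι) (x : ι → K) (ξ : ι → Ordinal.{0}), (∀ i, ξ i < r (x i)) ∧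
      ∀ k, ∀ ζ < r k, ∀ A ∈ 𝓝 k, {i | x i ∈ A ∧ ξ i = ζ}.Infinite := by
  let D : Set (Set K × Ordinal.{0}) := {p | p.1 ∈ countableBasis K ∧ ∃ y ∈ p.1, p.2 < r y}
  have hD : D.Countable := by
    obtain ⟨s, hs, hsU⟩ := TopologicalSpace.countable_cover_nhds hr
    have h1 : (⋃ y ∈ s, Iio (r y)).Countable :=
      hs.biUnion fun y _ => countable_Iio_of_lt_omega_one (hω y)
    refine ((countable_countableBasis K).prod h1).mono ?_
    rintro ⟨b, ζ⟩ ⟨hb, y, hy, hζ⟩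
    have hyU : y ∈ ⋃ z ∈ s, {w | r w ≤ r z} := hsU ▸ mem_univ y
    obtain ⟨z, hz, hyz⟩ := mem_iUnion₂.1 hyU
    exact ⟨hb, mem_iUnion₂.2 ⟨z, hz, hζ.trans_le hyz⟩⟩
  have : Countable D := hD.to_subtype
  choose y hy using fun d : D => d.2.2
  -- Shrinking the countable index set to `Type` keeps the glued space in the universe of `K`.
  let e := (equivShrink.{0} (D × ℕ)).symm
  refine ⟨Shrink.{0} (D × ℕ), e.injective.countable, fun i => y (e i).1, fun i => (e i).1.1.2,
    fun i => (hy _).2, fun k ζ hζ A hA => ?_⟩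
  obtain ⟨b, hb, hkb, hbA⟩ := (isBasis_countableBasis K).mem_nhds_iff.1 hA
  let d : D := ⟨(b, ζ), hb, k, hkb, hζ⟩
  refine infinite_of_injective_forall_mem (f := fun n : ℕ => e.symm (d, n)) (fun m n hmn => ?_)
    fun n => ?_
  · exact congrArg Prod.snd (e.symm.injective hmn)
  · change y (e (e.symm (d, n))).1 ∈ A ∧ (e (e.symm (d, n))).1.1.2 = ζ
    rw [e.apply_symm_apply]
    exact ⟨hbA (hy d).1, rfl⟩

/-- `W` realises the pair `(K, r)`: it contains `K` as a closed set with height function extending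
`r`, and retracts properly on `K` decreasing heights off `K`. -/
structure Realisation {K : Type u} [TopologicalSpace K] (r : K → Ordinal.{0}) : Type (u + 1) where
  carrier : Type u
  [top : TopologicalSpace carrier]
  [t2 : T2Space carrier]
  [locallyCompact : LocallyCompactSpace carrier]
  [totallyDisconnected : TotallyDisconnectedSpace carrier]
  [secondCountable : SecondCountableTopology carrier]
  incl : K → carrier
  proj : carrier → K
  height : carrier → Ordinal.{0}
  isEmbedding_incl : IsEmbedding incl
  isCompact_preimage : ∀ {C : Set K}, IsCompact C → IsCompact (proj ⁻¹' C)
  isHeight : IsHeight (range incl) height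
  height_incl : ∀ k, height (incl k) = r k
  height_lt : ∀ w ∉ range incl, height w < r (proj w)

attribute [instance] Realisation.top Realisation.t2 Realisation.locallyCompact
  Realisation.totallyDisconnected Realisation.secondCountable

theorem nonempty_realisation_of_scatteredModel {K : Type u} [TopologicalSpace K] [T2Space K]
    [LocallyCompactSpace K] [TotallyDisconnectedSpace K] [SecondCountableTopology K]
    {r : K → Ordinal.{0}} (hr : ∀ k, ∀ᶠ y in 𝓝 k, r y ≤ r k) (hω : ∀ k, r k < ω₁)
    (hS : ∀ k, ∀ ζ < r k, Nonempty (ScatteredModel ζ)) : Nonempty (Realisation r) := by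
  obtain ⟨ι, _, x, ξ, hξ, hdense⟩ := exists_attaching_points hr hω
  let S : ∀ i, ScatteredModel (ξ i) := fun i => (hS _ _ (hξ i)).some
  have : LocallyCompactSpace (glueSet S x) := isClosed_glueSet.locallyCompactSpace
  exact ⟨{
    carrier := glueSet S x
    incl := glueBase S x
    proj := glueProj S x
    height := glueHeight S x r
    isEmbedding_incl := isEmbedding_glueBase
    isCompact_preimage := isCompact_preimage_glueProj
    isHeight := isHeight_glueHeight hr hξ hdense
    height_incl := glueHeight_base r
    height_lt := fun _ => glueHeight_lt hξ }⟩

theorem IsHeight.empty_of_singleton {Z : Type u} [TopologicalSpace Z] [T1Space Z] {z : Z}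
    {h : Z → Ordinal.{0}} (H : IsHeight {z} h) : IsHeight ∅ h := by
  refine ⟨isClosed_empty, fun x => ?_, fun x ζ hζ =>
    (H.freq x ζ hζ).mono fun y hy => ⟨notMem_empty y, hy.2⟩⟩
  have h1 : ∀ᶠ y in 𝓝[≠] x, y ≠ z := by
    by_cases hx : x = z
    · exact hx ▸ self_mem_nhdsWithin
    · exact nhdsWithin_le_nhds (isOpen_compl_singleton.mem_nhds hx)
  filter_upwards [H.lt x, h1] with y hy hyz _
  exact hy hyz

/-- Realise the constant `ξ` over one point, using models of smaller height. Properness makes the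
result compact, and the base point, no longer counted as kernel, is the apex. -/
theorem nonempty_scatteredModel {ξ : Ordinal.{0}} (hξ : ξ < ω₁) : Nonempty (ScatteredModel ξ) := by
  induction ξ using WellFoundedLT.induction with
  | ind ξ ih =>
    obtain ⟨R⟩ := nonempty_realisation_of_scatteredModel (K := PUnit.{1}) (r := fun _ => ξ)
      (fun k => Eventually.of_forall fun _ => le_rfl) (fun _ => hξ)
      (fun _ ζ hζ => ih ζ hζ (hζ.trans hξ))
    have hrange : range R.incl = {R.incl PUnit.unit} := by
      ext w
      constructor
      · rintro ⟨⟨⟩, rfl⟩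
        rfl
      · rintro rfl
        exact ⟨_, rfl⟩
    have : CompactSpace R.carrier := ⟨R.isCompact_preimage isCompact_univ⟩
    refine ⟨{
      carrier := R.carrier
      height := R.height
      isHeight := (hrange ▸ R.isHeight).empty_of_singleton
      le := fun s => ?_
      apex := R.incl PUnit.unit
      height_apex := R.height_incl _ }⟩
    by_cases hs : s ∈ range R.incl
    · obtain ⟨k, rfl⟩ := hs
      exact (R.height_incl k).le
    · exact (R.height_lt s hs).le

theorem nonempty_realisation {K : Type u} [TopologicalSpace K] [T2Space K]
    [LocallyCompactSpace K] [TotallyDisconnectedSpace K] [SecondCountableTopology K]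
    {r : K → Ordinal.{0}} (hr : ∀ k, ∀ᶠ y in 𝓝 k, r y ≤ r k) (hω : ∀ k, r k < ω₁) :
    Nonempty (Realisation r) :=
  nonempty_realisation_of_scatteredModel hr hω fun k _ hζ =>
    nonempty_scatteredModel (hζ.trans (hω k))

/-! ### Reading Cantor-Bendixson data from a height function. -/

section HeightToRank

variable {W : Type u} [TopologicalSpace W] [T2Space W] {K : Set W} {h : W → Ordinal.{0}}

omit [T2Space W] in
theorem IsHeight.lt_iff_frequently (H : IsHeight K h) {x : W} {ζ : Ordinal.{0}} :
    ζ < h x ↔ ∃ᶠ y in 𝓝[≠] x, y ∉ K ∧ ζ ≤ h y := by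
  refine ⟨fun hζ => (H.freq x ζ hζ).mono fun y hy => ⟨hy.1, hy.2.ge⟩, fun hf => ?_⟩
  obtain ⟨y, hy, hlt⟩ := (hf.and_eventually (H.lt x)).exists
  exact hy.2.trans_lt (hlt hy.1)

theorem IsHeight.mem_cb_iff (H : IsHeight K h) (hK : K ⊆ derivedSet K) {x : W} {ξ : Ordinal.{0}} :
    x ∈ cb W ξ ↔ x ∈ K ∨ ξ ≤ h x := by
  induction ξ using WellFoundedLT.induction generalizing x with
  | ind ξ ih =>
    have h1 : ∀ ζ < ξ, x ∈ cb W (ζ + 1) ↔ x ∈ K ∨ ζ < h x := by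
      intro ζ hζ
      rw [cb_succ]
      by_cases hx : x ∈ K
      · simp only [hx, true_or, iff_true]
        exact derivedSet_mono _ _ (fun y hy => (ih ζ hζ).2 (Or.inl hy)) (hK hx)
      · have hev : ∀ᶠ y in 𝓝[≠] x, y ∉ K :=
          nhdsWithin_le_nhds (H.isClosed.isOpen_compl.mem_nhds hx)
        rw [mem_derivedSet, accPt_iff_frequently_nhdsNE, H.lt_iff_frequently]
        simp only [hx, false_or]
        refine frequently_congr ?_
        filter_upwards [hev] with y hy
        rw [ih ζ hζ]
        simp [hy]
    rw [OmegaStone.mem_cb_iff]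
    by_cases hx : x ∈ K
    · simp only [hx, true_or, iff_true]
      exact fun ζ hζ => (h1 ζ hζ).2 (Or.inl hx)
    · simp only [hx, false_or]
      refine ⟨fun hcb => le_of_forall_lt fun ζ hζ => ?_, fun hle ζ hζ => ?_⟩
      · exact ((h1 ζ hζ).1 (hcb ζ hζ)).resolve_left hx
      · exact (h1 ζ hζ).2 (Or.inr (hζ.trans_le hle))

variable [SecondCountableTopology W]

/-- A point off `K` of height at least `ν` would produce one of height exactly `ν`, which lies in
`W^(ν)` but not in `W^(ν+1)`. -/
theorem IsHeight.kernel_eq (H : IsHeight K h) (hK : K ⊆ derivedSet K) : kernel W = K := by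
  ext x
  rw [kernel, H.mem_cb_iff hK]
  refine ⟨fun hx => by_contra fun hxK => ?_, Or.inl⟩
  have hle := hx.resolve_left hxK
  have hno : ∀ y, y ∉ K → h y ≠ nu W := by
    intro y hyK hy
    have h1 : y ∈ cb W (nu W) := (H.mem_cb_iff hK).2 (Or.inr hy.ge)
    rw [cb_nu, H.mem_cb_iff hK, hy] at h1
    exact h1.elim hyK (Order.lt_add_one_iff.2 le_rfl).not_ge
  rcases hle.eq_or_lt with he | hlt
  · exact hno x hxK he.symm
  · obtain ⟨y, hy⟩ := (H.freq x _ hlt).exists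
    exact hno y hy.1 hy.2

theorem IsHeight.rank_eq (H : IsHeight K h) (hK : K ⊆ derivedSet K) (x : kernel W) :
    (rank W x : Ordinal.{0}) = h x := by
  refine eq_of_forall_lt_iff fun ζ => ?_
  rw [lt_rank_iff, H.lt_iff_frequently, mem_closure_iff_frequently, frequently_nhdsWithin_iff]
  refine frequently_congr (Eventually.of_forall fun y => ?_)
  have hiff : ∀ w, w ∈ kernel W ↔ w ∈ K := fun w => by rw [H.kernel_eq hK]
  have hx : (x : W) ∈ K := (hiff x).1 x.2
  rw [Set.mem_sdiff, hiff, H.mem_cb_iff hK]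
  constructor
  · rintro ⟨hy, hyK⟩
    exact ⟨⟨hyK, hy.resolve_left hyK⟩, fun he => hyK (he ▸ hx)⟩
  · rintro ⟨⟨hyK, hy⟩, -⟩
    exact ⟨Or.inr hy, hyK⟩

omit [SecondCountableTopology W] in
theorem IsHeight.mem_cbLayer (H : IsHeight K h) (hK : K ⊆ derivedSet K) {x : W}
    {ξ : Ordinal.{0}} : x ∈ cbLayer W ξ ↔ x ∉ K ∧ h x = ξ := by
  rw [cbLayer, Set.mem_sdiff, H.mem_cb_iff hK, H.mem_cb_iff hK, Order.add_one_le_iff, not_or, not_lt]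
  constructor
  · rintro ⟨h1, h2, h3⟩
    exact ⟨h2, h3.antisymm (h1.resolve_left h2)⟩
  · rintro ⟨h1, h2⟩
    exact ⟨Or.inr h2.ge, h1, h2.le⟩

end HeightToRank

/-! ### Realisations are strongly uniform. -/

section Realisation

variable {K : Type u} [TopologicalSpace K] [PerfectSpace K] {r : K → Ordinal.{0}}

namespace Realisation

theorem range_subset_derivedSet (R : Realisation r) :
    range R.incl ⊆ derivedSet (range R.incl) := by
  have h1 := R.isEmbedding_incl.continuous.image_derivedSet R.isEmbedding_incl.injective
    (A := univ)
  rw [image_univ] at h1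
  rintro _ ⟨k, rfl⟩
  exact h1 ⟨k, PerfectSpace.univ_preperfect k (mem_univ k), rfl⟩

theorem kernel_eq (R : Realisation r) : kernel R.carrier = range R.incl :=
  R.isHeight.kernel_eq R.range_subset_derivedSet

/-- If `λ < ν`, some `w` off the kernel has height `λ`. Its projection has rank above `λ`, so it is
a limit of `W^(λ) \ K`, which is closed and disjoint from the kernel. -/
theorem isUniform (R : Realisation r) : IsUniform R.carrier := by
  have hle : lam R.carrier ≤ nu R.carrier := csInf_le' (by
    change IsClosed (kernel R.carrier \ kernel R.carrier)
    simp)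
  have hmem : IsClosed (cb R.carrier (lam R.carrier) \ kernel R.carrier) :=
    csInf_mem (s := {ξ | IsClosed (cb R.carrier ξ \ kernel R.carrier)}) ⟨nu R.carrier, by
      change IsClosed (kernel R.carrier \ kernel R.carrier)
      simp⟩
  refine hle.antisymm' (not_lt.1 fun hlt => ?_)
  have hne : cb R.carrier (lam R.carrier) ≠ cb R.carrier (lam R.carrier + 1) :=
    fun he => notMem_of_lt_csInf' hlt he
  have hsub : ¬ cb R.carrier (lam R.carrier) ⊆ cb R.carrier (lam R.carrier + 1) := fun hs =>
    hne (hs.antisymm (cb_antitone le_self_add))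
  obtain ⟨w, hw, hw'⟩ := not_subset.1 hsub
  obtain ⟨hwK, hwh⟩ := (R.isHeight.mem_cbLayer R.range_subset_derivedSet).1 ⟨hw, hw'⟩
  have hlt' : lam R.carrier < R.height (R.incl (R.proj w)) := by
    rw [R.height_incl, ← hwh]
    exact R.height_lt w hwK
  have hk : R.incl (R.proj w) ∈ kernel R.carrier := R.kernel_eq ▸ ⟨_, rfl⟩
  rw [← R.isHeight.rank_eq R.range_subset_derivedSet ⟨_, hk⟩, lt_rank_iff, hmem.closure_eq] at hlt'
  exact hlt'.2 hk

/-- For every `ξ`, the set `K_ξ` and the closure of the layer at `ξ` are compact together: the layer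
projects into `{r > ξ}` and the projection is proper, while conversely `K_ξ` is a closed subset of
that closure. -/
theorem isStronglyUniform [T2Space K] (R : Realisation r) : IsStronglyUniform R.carrier := by
  refine ⟨R.isUniform, ?_⟩
  unfold rhoU rho
  congr 1
  ext ξ
  have hrank := R.isHeight.rank_eq R.range_subset_derivedSet
  have habove : kernelAbove R.carrier ξ = R.incl '' {k | ξ < r k} := by
    ext w
    constructor
    · rintro ⟨hw, hlt⟩
      obtain ⟨k, rfl⟩ := R.kernel_eq ▸ hw
      rw [hrank, R.height_incl] at hlt
      exact ⟨k, hlt, rfl⟩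
    · rintro ⟨k, hk, rfl⟩
      refine ⟨R.kernel_eq ▸ ⟨k, rfl⟩, ?_⟩
      rw [hrank, R.height_incl]
      exact hk
  constructor
  · intro hc
    rw [mem_ofPred_eq, habove, ← R.isEmbedding_incl.isCompact_iff] at hc
    refine (R.isCompact_preimage hc).of_isClosed_subset isClosed_closure
      (closure_minimal (fun w hw => ?_) (R.isCompact_preimage hc).isClosed)
    obtain ⟨hwK, rfl⟩ := (R.isHeight.mem_cbLayer R.range_subset_derivedSet).1 hw
    exact R.height_lt w hwK
  · intro hc
    have heq : kernelAbove R.carrier ξ =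
        kernel R.carrier ∩ closure (cb R.carrier ξ \ kernel R.carrier) := by
      ext w
      constructor
      · rintro ⟨hw, hlt⟩
        exact ⟨hw, lt_rank_iff.1 hlt⟩
      · rintro ⟨hw, hcl⟩
        exact ⟨hw, lt_rank_iff.2 hcl⟩
    refine IsCompact.of_isClosed_subset hc
      (heq ▸ (isClosed_kernel _).inter isClosed_closure) fun w hw => ?_
    rw [habove] at hw
    obtain ⟨k, hk, rfl⟩ := hw
    refine mem_closure_iff_nhds.2 fun U hU => ?_
    obtain ⟨y, hyU, -, hy⟩ := R.isHeight.exists_mem (x := R.incl k) (ζ := ξ)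
      (by rwa [R.height_incl]) hU
    exact ⟨y, hyU, (R.isHeight.mem_cbLayer R.range_subset_derivedSet).2 hy⟩

theorem exists_homeomorph_kernel (R : Realisation r) :
    ∃ φ : kernel R.carrier ≃ₜ K, ∀ x, r (φ x) = rank R.carrier x := by
  let φ : kernel R.carrier ≃ₜ K :=
    (Homeomorph.setCongr R.kernel_eq).trans R.isEmbedding_incl.toHomeomorph.symm
  refine ⟨φ, fun x => ?_⟩
  have h1 : R.incl (φ x) = x := congrArg Subtype.val
    (R.isEmbedding_incl.toHomeomorph.apply_symm_apply (Homeomorph.setCongr R.kernel_eq x))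
  rw [R.isHeight.rank_eq R.range_subset_derivedSet, ← R.height_incl, h1]

end Realisation

end Realisation

/-! ### Assembling the classification. -/

theorem isOmegaStone_of_homeomorph {K : Type u} {C : Type v} [TopologicalSpace K]
    [TopologicalSpace C] [T2Space C] [LocallyCompactSpace C] [TotallyDisconnectedSpace C]
    [SecondCountableTopology C] (e : K ≃ₜ C) : IsOmegaStone K where
  t2 := e.symm.t2Space
  locallyCompact := e.isClosedEmbedding.locallyCompactSpace
  totallyDisconnected := e.isEmbedding.isTotallyDisconnected_range.1
    (isTotallyDisconnected_of_totallyDisconnectedSpace _)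
  secondCountable := e.secondCountableTopology

theorem IsAdmissible.isOmegaStone {K : Type u} [TopologicalSpace K] {r : K → CountableOrdinal}
    (hr : IsAdmissible r) : IsOmegaStone K ∧ PerfectSpace K ∧ Nonempty K := by
  have : LocallyCompactSpace D₀ := isOpenEmbedding_puncturedInclusion.locallyCompactSpace
  have : TotallyDisconnectedSpace D₀ :=
    isEmbedding_puncturedInclusion.isTotallyDisconnected_range.1
      (isTotallyDisconnected_of_totallyDisconnectedSpace _)
  obtain ⟨he, -⟩ := hr
  rcases he with ⟨⟨e⟩⟩ | ⟨⟨e⟩⟩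
  · exact ⟨isOmegaStone_of_homeomorph e, perfectSpace_of_isOpenMap e.isOpenMap,
      ⟨e.symm ⟨1 / 4, quarter_mem_cantorSet, by norm_num⟩⟩⟩
  · exact ⟨isOmegaStone_of_homeomorph e, perfectSpace_of_isOpenMap e.isOpenMap,
      ⟨e.symm ⟨0, zero_mem_cantorSet⟩⟩⟩

theorem IsAdmissible.exists_stronglyUniformSpace {K : Type u} [TopologicalSpace K]
    {r : K → CountableOrdinal} (hr : IsAdmissible r) :
    ∃ W : StronglyUniformSpace.{u}, RankIso (rank W.carrier) r := by
  obtain ⟨⟨_, _, _, _⟩, _, _⟩ := hr.isOmegaStone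
  -- Semicontinuity is applied at the bound `r k + 1`, still countable; being below it means being
  -- at most `r k`.
  have husc : ∀ k, ∀ᶠ y in 𝓝 k, (r y : Ordinal.{0}) ≤ r k := fun k =>
    (hr.2 k ⟨_, (Cardinal.isSuccLimit_omega 1).add_one_lt (r k).2⟩
      (show (r k : Ordinal.{0}) < r k + 1 from Order.lt_add_one_iff.2 le_rfl)).mono fun y hy => Order.lt_add_one_iff.1 hy
  obtain ⟨R⟩ := nonempty_realisation husc fun k => (r k).2
  have : IsOmegaStone R.carrier := ⟨inferInstance, inferInstance, inferInstance, inferInstance⟩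
  have : Nonempty R.carrier := ‹Nonempty K›.map R.incl
  obtain ⟨φ, hφ⟩ := R.exists_homeomorph_kernel
  exact ⟨⟨R.carrier, R.isStronglyUniform⟩, φ, fun x => Subtype.ext (hφ x)⟩

theorem StronglyUniformSpace.isAdmissible (W : StronglyUniformSpace.{u}) :
    IsAdmissible (rank W.carrier) := by
  obtain ⟨_, _, _, _⟩ := W.isOmegaStone
  exact W.isStronglyUniform.1.isAdmissible_rank

theorem nonempty_homeomorph_iff_rankIso {W : Type u} {X : Type v} [TopologicalSpace W]
    [TopologicalSpace X] [hW : IsOmegaStone W] [hX : IsOmegaStone X] (hWu : IsStronglyUniform W)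
    (hXu : IsStronglyUniform X) : Nonempty (W ≃ₜ X) ↔ RankIso (rank W) (rank X) := by
  obtain ⟨_, _, _, _⟩ := hW
  obtain ⟨_, _, _, _⟩ := hX
  exact ⟨fun ⟨f⟩ => rankIso_of_homeomorph f, fun h => h.nonempty_homeomorph hWu hXu⟩

end OmegaStone

theorem mainTheorem3 :
    (∀ (W : Type u) (X : Type v) [TopologicalSpace W] [TopologicalSpace X]
        [OmegaStone.IsOmegaStone W] [OmegaStone.IsOmegaStone X],
        OmegaStone.IsStronglyUniform W → OmegaStone.IsStronglyUniform X →
        (Nonempty (W ≃ₜ X) ↔ OmegaStone.RankIso (OmegaStone.rank W) (OmegaStone.rank X))) ∧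
    ∃ Φ : OmegaStone.StronglyUniformClass.{u} → OmegaStone.RankPairClass.{u},
      (∀ W : OmegaStone.StronglyUniformSpace.{u},
        ∃ h : OmegaStone.IsAdmissible (OmegaStone.rank W.carrier),
          Φ (Quotient.mk _ W) =
            Quotient.mk _ ⟨OmegaStone.kernel W.carrier, OmegaStone.rank W.carrier, h⟩) ∧
      Function.Bijective Φ := by
  refine ⟨fun W X _ _ _ _ => OmegaStone.nonempty_homeomorph_iff_rankIso, ?_⟩
  let F : OmegaStone.StronglyUniformSpace.{u} → OmegaStone.RankPair.{u} := fun W =>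
    ⟨OmegaStone.kernel W.carrier, OmegaStone.rank W.carrier, W.isAdmissible⟩
  have hF : ∀ W X : OmegaStone.StronglyUniformSpace.{u}, W ≈ X ↔ F W ≈ F X := fun W X =>
    OmegaStone.nonempty_homeomorph_iff_rankIso W.isStronglyUniform X.isStronglyUniform
  refine ⟨Quotient.map F fun W X h => (hF W X).1 h, fun W => ⟨W.isAdmissible, rfl⟩, ?_, ?_⟩
  · intro a b
    induction a using Quotient.inductionOn with | h W => ?_
    induction b using Quotient.inductionOn with | h X => ?_
    exact fun h => Quotient.sound ((hF W X).2 (Quotient.exact h))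
  · intro b
    induction b using Quotient.inductionOn with | h p => ?_
    obtain ⟨W, hW⟩ := p.isAdmissible.exists_stronglyUniformSpace
    exact ⟨Quotient.mk _ W, Quotient.sound hW⟩
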